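/- Let $\mathfrak{S}_m$ be the set of permutations $\pi=\pi_1\pi_2\cdots\pi_m$ of $\{1,\dots,m\}$, and let $g,\ell\ge 1$ be integers. For $\pi\in\mathfrak{S}_m$ let $$E(\pi)=\{\,i\in\{1,\dots,m\} : \pi_i\ge i+g \text{ and } \pi_i\ge \ell\,\}$$ be the set of $g$-gap $\ell$-level excedance places of $\pi$. Define the $g$-gap $\ell$-level excedance number $$g\mathsf{exc}_\ell(\pi)=|\{\,i\in E(\pi) : i\ge \ell\,\}|=|\{\,i : \pi_i\ge i+g,\ i\ge\ell\,\}|$$ and the $g$-gap $\ell$-level Denert statistic $$g\mathsf{den}_\ell(\pi)=\sum_{i\in E(\pi)}(i+g-1)+\mathsf{inv}\big(\pi|_{E(\pi)}\big)+\mathsf{inv}\big(\pi|_{\{1,\dots,m\}\setminus E(\pi)}\big),$$ where, for a set $S$ of places, $\pi|_S$ is the subword of $\pi$ formed by the letters at the places in $S$, and $\mathsf{inv}$ of a word is its number of inversions. Theorem. Let $g,\ell\ge 1$ and $n\ge g+\ell$. There is a bijection $\phi:\mathfrak{S}_{n-1}\times\{0,1,\dots,n-1\}\to\mathfrak{S}_n$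 such that for all $\pi\in\mathfrak{S}_{n-1}$ and $0\le c\le n-1$, $$g\mathsf{exc}_\ell(\phi(\pi,c))=\begin{cases} g\mathsf{exc}_\ell(\pi) & \text{if } c\le g\mathsf{exc}_\ell(\pi)+g+\ell-2,\\ g\mathsf{exc}_\ell(\pi)+1 & \text{otherwise,}\end{cases}$$ and $$g\mathsf{den}_\ell(\phi(\pi,c))=g\mathsf{den}_\ell(\pi)+c.$$ -/

import Mathlib

/-! Permutations of `{1, …, m}` are elements of `Equiv.Perm (Fin m)`: the index `i : Fin m` stands
for the place `i + 1`, and the letter of `π` at that place is `(π i : ℕ) + 1`. -/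

/-- The set of `g`-gap `ℓ`-level excedance places of `π`: the letter at the place is at least
the place plus `g`, and at least `ℓ`. -/
def gapExcPlaces (g ℓ : ℕ) {m : ℕ} (π : Equiv.Perm (Fin m)) : Finset (Fin m) :=
  Finset.univ.filter fun i =>
    ((i : ℕ) + 1) + g ≤ (π i : ℕ) + 1 ∧ ℓ ≤ (π i : ℕ) + 1

/-- The number of inversions of the subword of `π` formed by the letters at the places in `S`. -/
def subwordInv {m : ℕ} (π : Equiv.Perm (Fin m)) (S : Finset (Fin m)) : ℕ :=
  ((S ×ˢ S).filter fun p => p.1 < p.2 ∧ π p.2 < π p.1).card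

/-- The `g`-gap `ℓ`-level excedance number: the number of `g`-gap `ℓ`-level excedance letters
of `π` that occur at a place `≥ ℓ`. -/
def gapExc (g ℓ : ℕ) {m : ℕ} (π : Equiv.Perm (Fin m)) : ℕ :=
  ((gapExcPlaces g ℓ π).filter fun i : Fin m => ℓ ≤ (i : ℕ) + 1).card

/-- The `g`-gap `ℓ`-level Denert statistic: the sum of `i + g - 1` over the excedance places `i`,
plus the inversions of the excedance subword, plus the inversions of the subword of all other
letters. -/
def gapDen (g ℓ : ℕ) {m : ℕ} (π : Equiv.Perm (Fin m)) : ℕ :=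
  (∑ i ∈ gapExcPlaces g ℓ π, (((i : ℕ) + 1) + g - 1))
    + subwordInv π (gapExcPlaces g ℓ π)
    + subwordInv π (gapExcPlaces g ℓ π)ᶜ

/-! Places and letters are counted from 0; put `L = ℓ - 1` and `N = n - 1`. The level in the Denert
statistic is first raised from `ℓ` to `ℓ + g` by a bijection preserving the excedance number
(`exists_bijective_permDen_level`). At the new level, a place up to `L` is an excedance exactly when
its letter is at least `g + L`, wherever it stands. There a new place `p ≥ L` is inserted into `π`.
Let `B` be the set of excedance letters. The new place takes the least element of `B ∪ {N}` that is
at least `v = min (p + g - 1) N`, and each excedance letter from `v` on moves up to the next element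
of `B ∪ {N}`. Old places keep their status, and the change of the statistic depends only on `p` and
`B` (`permDen_insPerm`). Insertion at `p = L` is expanded into `L + 1` options: each exchange by
`raiseKey` permutes the first `L + 1` letters and lowers the statistic by one. The resulting `N + 1`
changes are distinct numbers in `{0, …, N}`: the values below `g` come from `v = N`, the next `|B|`
from `v ∈ B`, the next `L + 1` from the exchanges, and the rest from `v` outside `B ∪ {N}`
(`insShift_cases`, `enlargeShift_injOn`). So `c` selects the option. Injectivity holds because the
inserted place is the last one satisfying `IsSlot`; equal cardinalities give bijectivity. -/

/-! ### Marked words and the insertion of one place -/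

/-- The Denert-type weight of a word `w` with a marked set `E` of places: the sum of `i + g` over
the marked places `i`, plus the number of inversions between places that are both marked or both
unmarked. -/
def wordDen (g : ℕ) {n : ℕ} (E : Fin n → Bool) (w : Fin n → ℕ) : ℕ :=
  (∑ i, if E i then (i : ℕ) + g else 0) +
    ∑ i, ∑ j, if i < j ∧ w j < w i ∧ E i = E j then 1 else 0

/-- The third summand appears because marked places from `p` on move one to the right. Order has to
be preserved only between places of equal status, which is all that bumping the excedance letters
guarantees. -/
theorem wordDen_insert (g : ℕ) {n : ℕ} (p : Fin (n + 1)) (E : Fin (n + 1) → Bool)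
    (w : Fin (n + 1) → ℕ) (E' : Fin n → Bool) (u : Fin n → ℕ)
    (hE : ∀ i, E (p.succAbove i) = E' i)
    (hu : ∀ i j, E' i = E' j → (w (p.succAbove i) < w (p.succAbove j) ↔ u i < u j)) :
    wordDen g E w = wordDen g E' u + (if E p then (p : ℕ) + g else 0)
      + (∑ i : Fin n, if E' i ∧ (p : ℕ) ≤ i then 1 else 0)
      + ((∑ i : Fin n, if E' i = E p ∧ (i : ℕ) < p ∧ w p < w (p.succAbove i) then 1 else 0)
      + ∑ i : Fin n, if E' i = E p ∧ (p : ℕ) ≤ i ∧ w (p.succAbove i) < w p then 1 else 0) := by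
  unfold wordDen
  have hlt : ∀ i : Fin n, (p.succAbove i < p ↔ (i : ℕ) < p) := fun i => by
    rw [Fin.succAbove_lt_iff_castSucc_lt, Fin.lt_def]; rfl
  have hgt : ∀ i : Fin n, (p < p.succAbove i ↔ (p : ℕ) ≤ i) := fun i => by
    rw [Fin.lt_succAbove_iff_le_castSucc, Fin.le_def]; rfl
  have h1 : (∑ i, if E i then (i : ℕ) + g else 0) = (if E p then (p : ℕ) + g else 0) +
      ((∑ i : Fin n, if E' i then (i : ℕ) + g else 0) +
        ∑ i : Fin n, if E' i ∧ (p : ℕ) ≤ i then 1 else 0) := by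
    rw [Fin.sum_univ_succAbove _ p, ← Finset.sum_add_distrib]
    congr 1
    refine Finset.sum_congr rfl fun i _ => ?_
    rw [hE]
    have hv : ((p.succAbove i : Fin (n + 1)) : ℕ) = if (i : ℕ) < p then (i : ℕ) else i + 1 := by
      simp only [Fin.succAbove, Fin.lt_def, Fin.val_castSucc]
      split_ifs <;> simp
    rw [hv]
    cases E' i <;> simp
    split_ifs <;> omega
  have h2 : (∑ i, ∑ j, if i < j ∧ w j < w i ∧ E i = E j then 1 else 0) =
      (∑ i : Fin n, if E' i = E p ∧ (p : ℕ) ≤ i ∧ w (p.succAbove i) < w p then 1 else 0) +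
      ((∑ i : Fin n, if E' i = E p ∧ (i : ℕ) < p ∧ w p < w (p.succAbove i) then 1 else 0) +
      ∑ i, ∑ j, if i < j ∧ u j < u i ∧ E' i = E' j then 1 else 0) := by
    rw [Fin.sum_univ_succAbove _ p, Fin.sum_univ_succAbove _ p]
    simp only [lt_self_iff_false, false_and, if_false, zero_add]
    congr 1
    · refine Finset.sum_congr rfl fun i _ => ?_
      rw [hE]
      refine if_congr ?_ rfl rfl
      rw [hgt, eq_comm (a := E p)]; tauto
    · rw [← Finset.sum_add_distrib]
      refine Finset.sum_congr rfl fun i _ => ?_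
      rw [Fin.sum_univ_succAbove _ p, hE]
      congr 1
      · refine if_congr ?_ rfl rfl
        rw [hlt]; tauto
      · refine Finset.sum_congr rfl fun j _ => ?_
        rw [hE]
        refine if_congr ?_ rfl rfl
        rw [Fin.succAbove_lt_succAbove_iff]
        constructor
        · rintro ⟨a, b, c⟩; exact ⟨a, (hu j i c.symm).1 b, c⟩
        · rintro ⟨a, b, c⟩; exact ⟨a, (hu j i c.symm).2 b, c⟩
  rw [h1, h2]
  omega

/-! ### The two statistics as sums of indicators -/

/-- The excedance indicator with gap `g` and level `t`, places and letters counted from `0`. -/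
def excMark (g t : ℕ) {n : ℕ} (w : Fin n → ℕ) (i : Fin n) : Bool :=
  decide ((i : ℕ) + g ≤ w i ∧ t ≤ w i + 1)

theorem excMark_iff {g t n : ℕ} {w : Fin n → ℕ} {i : Fin n} :
    excMark g t w i = true ↔ (i : ℕ) + g ≤ w i ∧ t ≤ w i + 1 := by
  simp [excMark]

/-- The word of letters, counted from `0`, of a permutation. -/
def permWord {n : ℕ} (π : Equiv.Perm (Fin n)) (i : Fin n) : ℕ := π i

/-- The Denert-type statistic with gap `g` and level `t`. -/
def permDen (g t : ℕ) {n : ℕ} (π : Equiv.Perm (Fin n)) : ℕ :=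
  wordDen g (excMark g t (permWord π)) (permWord π)

theorem gapDen_eq_permDen (g ℓ : ℕ) {n : ℕ} (π : Equiv.Perm (Fin n)) :
    gapDen g ℓ π = permDen g ℓ π := by
  have hmem : ∀ i, i ∈ gapExcPlaces g ℓ π ↔ excMark g ℓ (permWord π) i = true := fun i => by
    simp only [gapExcPlaces, Finset.mem_filter, Finset.mem_univ, true_and, excMark_iff, permWord]
    omega
  have hinv : ∀ S : Finset (Fin n), subwordInv π S =
      ∑ i, ∑ j, if i < j ∧ π j < π i ∧ i ∈ S ∧ j ∈ S then 1 else 0 := fun S => by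
    rw [subwordInv, ← Fintype.sum_prod_type', Finset.card_eq_sum_ones, Finset.sum_filter,
      ← Finset.sum_subset (Finset.subset_univ (S ×ˢ S))]
    · refine Finset.sum_congr rfl fun x hx => ?_
      rw [Finset.mem_product] at hx
      simp [hx.1, hx.2]
    · intro x _ hx
      rw [Finset.mem_product] at hx
      rw [if_neg]; tauto
  unfold gapDen permDen wordDen
  rw [hinv, hinv, add_assoc]
  congr 1
  · rw [← Finset.sum_filter]
    have : gapExcPlaces g ℓ π =
        Finset.univ.filter fun i => excMark g ℓ (permWord π) i = true := by
      ext i; simp [hmem]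
    rw [this]
    exact Finset.sum_congr rfl fun i _ => by omega
  · rw [← Finset.sum_add_distrib]
    refine Finset.sum_congr rfl fun i _ => ?_
    rw [← Finset.sum_add_distrib]
    refine Finset.sum_congr rfl fun j _ => ?_
    simp only [Finset.mem_compl, hmem]
    simp only [show permWord π = fun i => (π i : ℕ) from rfl, Fin.val_fin_lt]
    generalize excMark g ℓ (fun i => (π i : ℕ)) i = a
    generalize excMark g ℓ (fun i => (π i : ℕ)) j = b
    by_cases h1 : i < j <;> by_cases h2 : π j < π i <;> cases a <;> cases b <;> simp [h1, h2]

theorem gapExc_eq_sum (g ℓ : ℕ) {n : ℕ} (π : Equiv.Perm (Fin n)) :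
    gapExc g ℓ π = ∑ i : Fin n, if (i : ℕ) + g ≤ π i ∧ ℓ ≤ (i : ℕ) + 1 then 1 else 0 := by
  rw [gapExc, gapExcPlaces, Finset.filter_filter, Finset.card_filter]
  exact Finset.sum_congr rfl fun i _ => if_congr (by omega) rfl rfl

/-- Writes a number as a sum of indicators, so that identities between counts can be checked place
by place. -/
theorem Fin.sum_val_lt {n v : ℕ} (hv : v ≤ n) :
    (∑ i : Fin n, if (i : ℕ) < v then 1 else 0) = v := by
  rw [Fin.sum_univ_eq_sum_range (fun i => if i < v then 1 else 0), ← Finset.sum_filter,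
    Finset.sum_const, smul_eq_mul, mul_one]
  have : (Finset.range n).filter (· < v) = Finset.range v := by
    ext x; simp; omega
  rw [this, Finset.card_range]

theorem Fin.val_succAbove_eq {n : ℕ} (p : Fin (n + 1)) (i : Fin n) :
    ((p.succAbove i : Fin (n + 1)) : ℕ) = if (i : ℕ) < p then (i : ℕ) else i + 1 := by
  simp only [Fin.succAbove, Fin.lt_def, Fin.val_castSucc]
  split_ifs <;> simp

/-! ### Raising the level from `ℓ` to `ℓ + g` -/

/-- The permutation of places that moves place `a` to place `b` and keeps the order of the
other places. -/
def slotMove {m : ℕ} (b a : Fin (m + 1)) : Equiv.Perm (Fin (m + 1)) :=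
  (finSuccEquiv' b).trans (finSuccEquiv' a).symm

theorem slotMove_self {m : ℕ} (b a : Fin (m + 1)) : slotMove b a b = a := by
  simp [slotMove]

theorem slotMove_succAbove {m : ℕ} (b a : Fin (m + 1)) (i : Fin m) :
    slotMove b a (b.succAbove i) = a.succAbove i := by
  simp [slotMove]

theorem slotMove_slotMove {m : ℕ} (b a x : Fin (m + 1)) :
    slotMove b a (slotMove a b x) = x := by
  simp [slotMove]

theorem slotMove_val_of_le {m : ℕ} (b a x : Fin (m + 1)) (hb : (b : ℕ) < x)
    (ha : (a : ℕ) < x) : slotMove b a x = x := by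
  obtain rfl | ⟨i, rfl⟩ := Fin.eq_self_or_eq_succAbove b x
  · omega
  · rw [slotMove_succAbove]
    ext
    rw [Fin.val_succAbove_eq] at *
    rw [Fin.val_succAbove_eq]
    split_ifs at * <;> omega

/-- Reflect the place `a` of the letter `x` within the first `P` places, keeping the order of the
other letters, if `a` is one of these places. -/
def reflectLetter {m : ℕ} (P : ℕ) (x : Fin (m + 1)) (π : Equiv.Perm (Fin (m + 1))) :
    Equiv.Perm (Fin (m + 1)) :=
  if h : (π.symm x : ℕ) < P then
    (slotMove ⟨min (P - 1 - π.symm x) m, by omega⟩ (π.symm x)).trans π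
  else π

theorem reflectLetter_of_lt {m P : ℕ} (x : Fin (m + 1)) (π : Equiv.Perm (Fin (m + 1)))
    {a b : Fin (m + 1)} (ha : π.symm x = a) (haP : (a : ℕ) < P) (hb : (b : ℕ) = P - 1 - a) :
    reflectLetter P x π = (slotMove b a).trans π := by
  subst ha
  rw [reflectLetter, dif_pos haP]
  congr 2
  ext
  simp only
  omega

theorem reflectLetter_involutive {m P : ℕ} (hP : P ≤ m + 1) (x : Fin (m + 1)) :
    Function.Involutive (reflectLetter P x) := by
  intro π
  obtain ⟨a, ha⟩ : ∃ a, π.symm x = a := ⟨_, rfl⟩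
  by_cases h : (a : ℕ) < P
  · obtain ⟨b, hb⟩ : ∃ b : Fin (m + 1), (b : ℕ) = P - 1 - a := ⟨⟨P - 1 - a, by omega⟩, rfl⟩
    rw [reflectLetter_of_lt x π ha h hb]
    have hx : ((slotMove b a).trans π).symm x = b := by
      rw [Equiv.symm_apply_eq, Equiv.trans_apply, slotMove_self, ← ha, Equiv.apply_symm_apply]
    rw [reflectLetter_of_lt x _ hx (b := a) (by omega) (by omega)]
    ext i
    simp [slotMove_slotMove]
  · have : reflectLetter P x π = π := by rw [reflectLetter, dif_neg (by rwa [ha])]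
    rw [this, this]

theorem gapExc_reflectLetter {m P g ℓ : ℕ} (hP : P ≤ m + 1) (hPℓ : P < ℓ) (x : Fin (m + 1))
    (π : Equiv.Perm (Fin (m + 1))) : gapExc g ℓ (reflectLetter P x π) = gapExc g ℓ π := by
  obtain ⟨a, ha⟩ : ∃ a, π.symm x = a := ⟨_, rfl⟩
  by_cases h : (a : ℕ) < P
  · obtain ⟨b, hb⟩ : ∃ b : Fin (m + 1), (b : ℕ) = P - 1 - a := ⟨⟨P - 1 - a, by omega⟩, rfl⟩
    rw [reflectLetter_of_lt x π ha h hb, gapExc_eq_sum, gapExc_eq_sum]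
    refine Finset.sum_congr rfl fun i _ => ?_
    by_cases hi : ℓ ≤ (i : ℕ) + 1
    · rw [Equiv.trans_apply, slotMove_val_of_le] <;> omega
    · simp [hi]
  · rw [reflectLetter, dif_neg (by rwa [ha])]

/-- Raising the level by one changes only the status of the letter `t`, and only if its place `a`
satisfies `a + g ≤ t`. Besides the number of other excedances, this letter contributes `a + g` when
marked and `t - b` when unmarked at place `b`; the reflection makes these equal. -/
theorem permDen_reflectLetter {m g t : ℕ} (hg : 1 ≤ g)
    (x : Fin (m + 1)) (hx : (x : ℕ) = t) (π : Equiv.Perm (Fin (m + 1))) :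
    permDen g (t + 2) (reflectLetter (t + 1 - g) x π) = permDen g (t + 1) π := by
  obtain ⟨a, ha⟩ : ∃ a, π.symm x = a := ⟨_, rfl⟩
  have hπa : π a = x := by rw [← ha, Equiv.apply_symm_apply]
  by_cases h : (a : ℕ) < t + 1 - g
  · obtain ⟨b, hbv⟩ : ∃ b : Fin (m + 1), (b : ℕ) = t + 1 - g - 1 - a :=
      ⟨⟨t + 1 - g - 1 - a, by omega⟩, rfl⟩
    rw [reflectLetter_of_lt x π ha h hbv]
    have hbP : (b : ℕ) + g ≤ t := by omega
    have hne : ∀ i, ((π (a.succAbove i) : Fin (m + 1)) : ℕ) ≠ t := fun i hi => by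
      have : π (a.succAbove i) = π a := by rw [hπa]; ext; omega
      exact Fin.succAbove_ne _ _ (π.injective this)
    unfold permDen
    rw [wordDen_insert g a (excMark g (t + 1) (permWord π)) (permWord π)
      (fun i => excMark g (t + 1) (permWord π) (a.succAbove i))
      (fun i => permWord π (a.succAbove i)) (fun _ => rfl) (fun _ _ _ => Iff.rfl),
      wordDen_insert g b _ _
      (fun i => excMark g (t + 1) (permWord π) (a.succAbove i))
      (fun i => permWord π (a.succAbove i)) ?_ ?_]
    · have hEa : excMark g (t + 1) (permWord π) a = true := by
        rw [excMark_iff, permWord, hπa]; omega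
      have hw : permWord ((slotMove b a).trans π) b = t := by
        rw [permWord, Equiv.trans_apply, slotMove_self, hπa, hx]
      have hEb : excMark g (t + 2) (permWord ((slotMove b a).trans π)) b = false := by
        rw [Bool.eq_false_iff, Ne, excMark_iff, hw]; omega
      have hwa : permWord π a = t := by rw [permWord, hπa, hx]
      have hws : ∀ i, permWord ((slotMove b a).trans π) (b.succAbove i) =
          permWord π (a.succAbove i) := fun i => by
        rw [permWord, Equiv.trans_apply, slotMove_succAbove, permWord]
      simp only [hEa, hEb, hw, hwa, hws]
      have h1 : ∑ i : Fin m, (if permWord π (a.succAbove i) < t then 1 else 0) = t := by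
        have := Fin.sum_val_lt (n := m + 1) (v := t) (by omega)
        rw [← Equiv.sum_comp π, Fin.sum_univ_succAbove _ a, hπa, hx] at this
        rw [if_neg (lt_irrefl t), zero_add] at this
        exact this
      have h2 : ∑ i : Fin m, (if (i : ℕ) < b then 1 else 0) = (b : ℕ) :=
        Fin.sum_val_lt (by omega)
      have h3 : ∑ i : Fin m, (if (i : ℕ) < a then 1 else 0) = (a : ℕ) :=
        Fin.sum_val_lt (by omega)
      have hE : ∀ i : Fin m, (excMark g (t + 1) (permWord π) (a.succAbove i) = true ↔
          ((i : ℕ) < a ∧ (i : ℕ) + g ≤ permWord π (a.succAbove i) ∨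
            ¬ (i : ℕ) < a ∧ (i : ℕ) + 1 + g ≤ permWord π (a.succAbove i)) ∧
          t < permWord π (a.succAbove i)) := fun i => by
        rw [excMark_iff, Fin.val_succAbove_eq]
        have := hne i
        rw [permWord]
        split_ifs <;> omega
      -- All other marked letters exceed `t`: one to the left gives an inversion, one to the right a
      -- shift of its place.
      have key1 : (∑ i : Fin m, if excMark g (t + 1) (permWord π) (a.succAbove i) = true ∧
              (a : ℕ) ≤ i then 1 else 0) +
          ((∑ i : Fin m, if excMark g (t + 1) (permWord π) (a.succAbove i) = true ∧
              (i : ℕ) < a ∧ t < permWord π (a.succAbove i) then 1 else 0) +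
          ∑ i : Fin m, if excMark g (t + 1) (permWord π) (a.succAbove i) = true ∧
              (a : ℕ) ≤ i ∧ permWord π (a.succAbove i) < t then 1 else 0) =
          ∑ i : Fin m, if excMark g (t + 1) (permWord π) (a.succAbove i) = true
            then 1 else 0 := by
        rw [← Finset.sum_add_distrib, ← Finset.sum_add_distrib]
        refine Finset.sum_congr rfl fun i _ => ?_
        simp only [hE]
        split_ifs <;> omega
      -- An unmarked letter left of `b` is below `t`, since `b + g ≤ t` would otherwise make it an
      -- excedance.
      have key2 : (∑ i : Fin m, if excMark g (t + 1) (permWord π) (a.succAbove i) = true ∧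
              (b : ℕ) ≤ i then 1 else 0) +
          ((∑ i : Fin m, if excMark g (t + 1) (permWord π) (a.succAbove i) = false ∧
              (i : ℕ) < b ∧ t < permWord π (a.succAbove i) then 1 else 0) +
          ∑ i : Fin m, if excMark g (t + 1) (permWord π) (a.succAbove i) = false ∧
              (b : ℕ) ≤ i ∧ permWord π (a.succAbove i) < t then 1 else 0) +
          (∑ i : Fin m, if (i : ℕ) < b then 1 else 0) =
          (∑ i : Fin m, if excMark g (t + 1) (permWord π) (a.succAbove i) = true
            then 1 else 0) +
          ∑ i : Fin m, if permWord π (a.succAbove i) < t then 1 else 0 := by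
        rw [← Finset.sum_add_distrib, ← Finset.sum_add_distrib, ← Finset.sum_add_distrib,
          ← Finset.sum_add_distrib]
        refine Finset.sum_congr rfl fun i _ => ?_
        simp only [← Bool.not_eq_true, hE]
        have := hne i
        rw [← permWord] at this
        split_ifs <;> omega
      simp only [if_true, Bool.false_eq_true, if_false]
      omega
    · intro i
      rw [Bool.eq_iff_iff, excMark_iff, excMark_iff, permWord, Equiv.trans_apply,
        slotMove_succAbove, permWord, Fin.val_succAbove_eq, Fin.val_succAbove_eq]
      have := hne i
      split_ifs <;> omega
    · intro i j _
      rw [permWord, permWord, Equiv.trans_apply, Equiv.trans_apply, slotMove_succAbove,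
        slotMove_succAbove]
      rfl
  · rw [reflectLetter, dif_neg (by rwa [ha])]
    unfold permDen
    congr 1
    ext i
    rw [Bool.eq_iff_iff, excMark_iff, excMark_iff]
    by_cases hi : (π i : ℕ) = t
    · have : π i = x := by ext; omega
      have : a = i := by rw [← ha, ← this, Equiv.symm_apply_apply]
      rw [this] at h
      rw [permWord]; omega
    · rw [permWord]; omega

/-- Step `k < g` moves letters only within the first `ℓ + k - g < ℓ` places, and these do not affect
`gapExc`. -/
theorem exists_bijective_permDen_level {m g ℓ : ℕ} (hg : 1 ≤ g) (hℓ : 1 ≤ ℓ)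
    (hm : g + ℓ ≤ m + 2) (k : ℕ) (hk : k ≤ g) :
    ∃ Λ : Equiv.Perm (Fin (m + 1)) → Equiv.Perm (Fin (m + 1)), Function.Bijective Λ ∧
      ∀ π, gapExc g ℓ (Λ π) = gapExc g ℓ π ∧ permDen g (ℓ + k) (Λ π) = permDen g ℓ π := by
  induction k with
  | zero => exact ⟨id, Function.bijective_id, fun π => ⟨rfl, rfl⟩⟩
  | succ k ih =>
    obtain ⟨Λ, hΛ, h⟩ := ih (by omega)
    have hx : ℓ + k - 1 < m + 1 := by omega
    refine ⟨fun π => reflectLetter (ℓ + k - 1 + 1 - g) ⟨ℓ + k - 1, hx⟩ (Λ π),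
      (reflectLetter_involutive (by omega) _).bijective.comp hΛ, fun π => ⟨?_, ?_⟩⟩
    · rw [gapExc_reflectLetter (by omega) (by omega), (h π).1]
    · have := permDen_reflectLetter (m := m) (g := g) (t := ℓ + k - 1) hg
        ⟨ℓ + k - 1, hx⟩ rfl (Λ π)
      rw [show ℓ + k - 1 + 2 = ℓ + (k + 1) by omega, show ℓ + k - 1 + 1 = ℓ + k by omega,
        (h π).2] at this
      rw [show ℓ + k - 1 + 1 = ℓ + k by omega]
      exact this

/-! ### Bumping the letters of a set upwards -/

/-- The least element of `insert N B` that is at least `t`. -/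
noncomputable def leastFrom (B : Finset ℕ) (N t : ℕ) : ℕ :=
  sInf {y | (y ∈ B ∨ y = N) ∧ t ≤ y}

theorem leastFrom_spec {B : Finset ℕ} {N t : ℕ} (ht : t ≤ N) :
    (leastFrom B N t ∈ B ∨ leastFrom B N t = N) ∧ t ≤ leastFrom B N t :=
  Nat.sInf_mem (s := {y | (y ∈ B ∨ y = N) ∧ t ≤ y}) ⟨N, Or.inr rfl, ht⟩

theorem leastFrom_le {B : Finset ℕ} {N t y : ℕ} (hy : y ∈ B ∨ y = N) (ht : t ≤ y) :
    leastFrom B N t ≤ y :=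
  Nat.sInf_le (s := {y | (y ∈ B ∨ y = N) ∧ t ≤ y}) ⟨hy, ht⟩

/-- Replace each element `x ≥ v` of `B` by the next larger element of `insert N B`. -/
noncomputable def bumpLetter (B : Finset ℕ) (N v x : ℕ) : ℕ :=
  if x ∈ B ∧ v ≤ x then leastFrom B N (x + 1) else x

section bump

variable {B : Finset ℕ} {N v x y : ℕ}

theorem bumpLetter_of_notMem (hx : x ∉ B) : bumpLetter B N v x = x :=
  if_neg fun h => hx h.1

theorem bumpLetter_of_lt (hx : x < v) : bumpLetter B N v x = x :=
  if_neg fun h => by omega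

theorem lt_bumpLetter (hB : ∀ x ∈ B, x < N) (hx : x ∈ B) (hv : v ≤ x) :
    x < bumpLetter B N v x := by
  rw [bumpLetter, if_pos ⟨hx, hv⟩]
  exact (leastFrom_spec (hB x hx)).2

theorem le_bumpLetter (hB : ∀ x ∈ B, x < N) : x ≤ bumpLetter B N v x := by
  by_cases h : x ∈ B ∧ v ≤ x
  · exact (lt_bumpLetter hB h.1 h.2).le
  · rw [bumpLetter, if_neg h]

theorem bumpLetter_mem (hB : ∀ x ∈ B, x < N) (hx : x ∈ B) :
    bumpLetter B N v x ∈ B ∨ bumpLetter B N v x = N := by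
  by_cases h : v ≤ x
  · rw [bumpLetter, if_pos ⟨hx, h⟩]
    exact (leastFrom_spec (hB x hx)).1
  · rw [bumpLetter_of_lt (by omega)]
    exact Or.inl hx

theorem bumpLetter_le_of_lt (hx : x ∈ B) (hy : y ∈ B ∨ y = N) (h : x < y) :
    bumpLetter B N v x ≤ y := by
  by_cases hv : v ≤ x
  · rw [bumpLetter, if_pos ⟨hx, hv⟩]
    exact leastFrom_le hy h
  · rw [bumpLetter_of_lt (by omega)]
    exact h.le

theorem bumpLetter_lt_bumpLetter (hB : ∀ x ∈ B, x < N) (hx : x ∈ B) (hy : y ∈ B)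
    (h : x < y) : bumpLetter B N v x < bumpLetter B N v y := by
  by_cases hv : v ≤ y
  · exact (bumpLetter_le_of_lt hx (Or.inl hy) h).trans_lt (lt_bumpLetter hB hy hv)
  · rwa [bumpLetter_of_lt (by omega), bumpLetter_of_lt (by omega)]

theorem bumpLetter_lt_iff (hB : ∀ x ∈ B, x < N) (hx : x ∈ B) (hy : y ∈ B) :
    bumpLetter B N v x < bumpLetter B N v y ↔ x < y := by
  refine ⟨fun h => ?_, bumpLetter_lt_bumpLetter hB hx hy⟩
  by_contra hxy
  rcases Nat.lt_or_eq_of_le (not_lt.1 hxy) with h' | rfl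
  · exact absurd (bumpLetter_lt_bumpLetter (v := v) hB hy hx h') (by omega)
  · omega

theorem bumpLetter_lt_leastFrom_iff (hB : ∀ x ∈ B, x < N) (hv : v ≤ N) (hx : x ∈ B) :
    bumpLetter B N v x < leastFrom B N v ↔ x < v := by
  constructor
  · intro h
    by_contra hvx
    have := lt_bumpLetter hB hx (not_lt.1 hvx)
    have := leastFrom_le (N := N) (Or.inl hx) (not_lt.1 hvx)
    omega
  · intro h
    rw [bumpLetter_of_lt h]
    exact h.trans_le (leastFrom_spec hv).2

theorem leastFrom_lt_bumpLetter_iff (hB : ∀ x ∈ B, x < N) (hv : v ≤ N) (hx : x ∈ B) :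
    leastFrom B N v < bumpLetter B N v x ↔ v ≤ x := by
  constructor
  · intro h
    by_contra hvx
    have := (bumpLetter_lt_leastFrom_iff hB hv hx).2 (not_le.1 hvx)
    omega
  · intro h
    exact (leastFrom_le (N := N) (Or.inl hx) h).trans_lt (lt_bumpLetter hB hx h)

theorem bumpLetter_ne_leastFrom (hB : ∀ x ∈ B, x < N) (hv : v ≤ N) (hx : x < N) :
    bumpLetter B N v x ≠ leastFrom B N v := by
  intro h
  by_cases hxB : x ∈ B
  · rcases Nat.lt_or_ge x v with h' | h'
    · exact absurd ((bumpLetter_lt_leastFrom_iff hB hv hxB).2 h') (by omega)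
    · exact absurd ((leastFrom_lt_bumpLetter_iff hB hv hxB).2 h') (by omega)
  · rw [bumpLetter_of_notMem hxB] at h
    rcases (leastFrom_spec (B := B) hv).1 with h' | h'
    · exact hxB (h ▸ h')
    · omega

theorem bumpLetter_injOn (hB : ∀ x ∈ B, x < N) (hx : x < N) (hy : y < N)
    (h : bumpLetter B N v x = bumpLetter B N v y) : x = y := by
  have aux : ∀ {x y : ℕ}, y < N → x ∈ B → y ∉ B →
      bumpLetter B N v x ≠ bumpLetter B N v y := fun {x y} hy hxB hyB h => by
    rw [bumpLetter_of_notMem hyB] at h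
    rcases bumpLetter_mem (v := v) hB hxB with h' | h'
    · exact hyB (h ▸ h')
    · omega
  by_cases hxB : x ∈ B <;> by_cases hyB : y ∈ B
  · rcases lt_trichotomy x y with h' | h' | h'
    · exact absurd ((bumpLetter_lt_iff (v := v) hB hxB hyB).2 h') (by omega)
    · exact h'
    · exact absurd ((bumpLetter_lt_iff (v := v) hB hyB hxB).2 h') (by omega)
  · exact absurd h (aux hy hxB hyB)
  · exact absurd h.symm (aux hx hyB hxB)
  · rwa [bumpLetter_of_notMem hxB, bumpLetter_of_notMem hyB] at h

theorem bumpLetter_le (hx : x < N) : bumpLetter B N v x ≤ N := by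
  by_cases hxB : x ∈ B
  · exact bumpLetter_le_of_lt hxB (Or.inr rfl) hx
  · rw [bumpLetter_of_notMem hxB]; exact hx.le

end bump

/-! ### Excedance letters and the inserted word -/

theorem permWord_injective {n : ℕ} (π : Equiv.Perm (Fin n)) : Function.Injective (permWord π) :=
  fun _ _ h => π.injective (Fin.ext h)

theorem permWord_inj {n : ℕ} {π ρ : Equiv.Perm (Fin n)} (h : permWord π = permWord ρ) :
    π = ρ :=
  Equiv.ext fun i => Fin.ext (congrFun h i)

/-- The set of letters at excedance places. -/
def excLetters (g t : ℕ) {n : ℕ} (w : Fin n → ℕ) : Finset ℕ :=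
  (Finset.univ.filter fun i => excMark g t w i = true).image w

theorem mem_excLetters {g t n : ℕ} {w : Fin n → ℕ} {x : ℕ} :
    x ∈ excLetters g t w ↔ ∃ i, excMark g t w i = true ∧ w i = x := by
  simp [excLetters]

theorem excMark_iff_mem_excLetters {g t n : ℕ} {w : Fin n → ℕ} (hw : Function.Injective w)
    {i : Fin n} : excMark g t w i = true ↔ w i ∈ excLetters g t w := by
  rw [mem_excLetters]
  exact ⟨fun h => ⟨i, h, rfl⟩, fun ⟨j, hj, h⟩ => hw h ▸ hj⟩

theorem lt_of_mem_excLetters {g t n : ℕ} {π : Equiv.Perm (Fin n)} :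
    ∀ x ∈ excLetters g t (permWord π), x < n := by
  intro x hx
  obtain ⟨i, -, rfl⟩ := mem_excLetters.1 hx
  exact (π i).2

theorem le_of_mem_excLetters {g t n : ℕ} {w : Fin n → ℕ} {x : ℕ} (hx : x ∈ excLetters g t w) :
    t ≤ x + 1 := by
  obtain ⟨i, h, rfl⟩ := mem_excLetters.1 hx
  exact (excMark_iff.1 h).2

theorem card_filter_excLetters {g t n : ℕ} {w : Fin n → ℕ} (hw : Function.Injective w) (v : ℕ) :
    ((excLetters g t w).filter (v ≤ ·)).card =
      ∑ i, if excMark g t w i = true ∧ v ≤ w i then 1 else 0 := by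
  rw [← Finset.card_filter, excLetters, Finset.filter_image, Finset.card_image_of_injective _ hw,
    Finset.filter_filter]

theorem card_excLetters {g t n : ℕ} {w : Fin n → ℕ} (hw : Function.Injective w) :
    (excLetters g t w).card = ∑ i, if excMark g t w i = true then 1 else 0 := by
  rw [← Finset.card_filter, excLetters, Finset.card_image_of_injective _ hw]

/-- The largest letter that is not an excedance when it is inserted at place `p` of a word of
length `N`. -/
def topLetter (g N p : ℕ) : ℕ := min (p + g - 1) N

/-- Insert a new place `p` into `π`, cascading the excedance letters. -/
noncomputable def insWord (g t : ℕ) {N : ℕ} (p : Fin (N + 1)) (π : Equiv.Perm (Fin N)) :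
    Fin (N + 1) → ℕ :=
  p.insertNth (α := fun _ => ℕ)
    (leastFrom (excLetters g t (permWord π)) N (topLetter g N p))
    fun i => bumpLetter (excLetters g t (permWord π)) N (topLetter g N p) (permWord π i)

section ins

variable {g t N : ℕ} (p : Fin (N + 1)) (π : Equiv.Perm (Fin N))

theorem insWord_self : insWord g t p π p =
    leastFrom (excLetters g t (permWord π)) N (topLetter g N p) := by
  simp [insWord]

theorem insWord_succAbove (i : Fin N) : insWord g t p π (p.succAbove i) =
    bumpLetter (excLetters g t (permWord π)) N (topLetter g N p) (permWord π i) := by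
  simp [insWord]

theorem topLetter_le : topLetter g N p ≤ N := min_le_right _ _

theorem insWord_lt (i : Fin (N + 1)) : insWord g t p π i < N + 1 := by
  obtain rfl | ⟨i, rfl⟩ := Fin.eq_self_or_eq_succAbove p i
  · rw [insWord_self, Nat.lt_succ_iff]
    exact leastFrom_le (Or.inr rfl) (topLetter_le _)
  · rw [insWord_succAbove, Nat.lt_succ_iff]
    exact bumpLetter_le (π i).2

theorem insWord_injective : Function.Injective (insWord g t p π) := by
  intro i j h
  rcases Fin.eq_self_or_eq_succAbove p i with hi | ⟨i, rfl⟩ <;>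
    rcases Fin.eq_self_or_eq_succAbove p j with hj | ⟨j, rfl⟩
  · rw [hi, hj]
  · rw [hi, insWord_self, insWord_succAbove] at h
    exact absurd h.symm
      (bumpLetter_ne_leastFrom lt_of_mem_excLetters (topLetter_le p) (π j).2)
  · rw [hj, insWord_self, insWord_succAbove] at h
    exact absurd h
      (bumpLetter_ne_leastFrom lt_of_mem_excLetters (topLetter_le p) (π i).2)
  · rw [insWord_succAbove, insWord_succAbove] at h
    rw [permWord_injective π (bumpLetter_injOn lt_of_mem_excLetters (π i).2 (π j).2 h)]

/-- The permutation with word `insWord`. -/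
noncomputable def insPerm (g t : ℕ) {N : ℕ} (p : Fin (N + 1)) (π : Equiv.Perm (Fin N)) :
    Equiv.Perm (Fin (N + 1)) :=
  Equiv.ofBijective (fun i => ⟨insWord g t p π i, insWord_lt p π i⟩)
    (Finite.injective_iff_bijective.1 fun _ _ h =>
      insWord_injective p π (congrArg Fin.val h))

theorem permWord_insPerm : permWord (insPerm g t p π) = insWord g t p π := rfl

end ins

/-! ### Effect of an insertion on the statistics -/

section insStat

variable {g L N : ℕ} {p : Fin (N + 1)}

/-- An excedance letter at a place from `p` on is at least `v`, hence grows by at least one, which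
makes up for its place moving by one. Letters at other places that are not excedances stay
unchanged. -/
theorem excMark_insWord_succAbove (hg : 1 ≤ g) (π : Equiv.Perm (Fin N)) (i : Fin N) :
    excMark g (g + L + 1) (insWord g (g + L + 1) p π) (p.succAbove i) =
      excMark g (g + L + 1) (permWord π) i := by
  rw [Bool.eq_iff_iff]
  by_cases h : excMark g (g + L + 1) (permWord π) i = true
  · rw [iff_true_right h]
    have hB := (excMark_iff_mem_excLetters (permWord_injective π)).1 h
    rw [excMark_iff] at h ⊢
    rw [insWord_succAbove, Fin.val_succAbove_eq]
    have h1 := le_bumpLetter (B := excLetters g (g + L + 1) (permWord π)) (N := N)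
      (v := topLetter g N p) (x := permWord π i) lt_of_mem_excLetters
    split_ifs with hi
    · omega
    · have := lt_bumpLetter (v := topLetter g N p) lt_of_mem_excLetters hB
        (by unfold topLetter; omega)
      omega
  · rw [iff_false_right h]
    have hB := mt (excMark_iff_mem_excLetters (permWord_injective π)).2 h
    rw [excMark_iff] at h ⊢
    rw [insWord_succAbove, Fin.val_succAbove_eq, bumpLetter_of_notMem hB]
    split_ifs with hi <;> omega

theorem insWord_self_of_mem (π : Equiv.Perm (Fin N))
    (h : topLetter g N p ∈ excLetters g (g + L + 1) (permWord π) ∨ topLetter g N p = N) :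
    insWord g (g + L + 1) p π p = topLetter g N p := by
  rw [insWord_self]
  exact le_antisymm (leastFrom_le h le_rfl) (leastFrom_spec (topLetter_le p)).2

/-- If `v` is not available in `B ∪ {N}`, the inserted letter is at least `p + g`, and `L ≤ p` puts
it above the level. -/
theorem excMark_insWord_self (hg : 1 ≤ g) (hp : L ≤ (p : ℕ))
    (π : Equiv.Perm (Fin N)) :
    excMark g (g + L + 1) (insWord g (g + L + 1) p π) p = true ↔
      ¬ (topLetter g N p ∈ excLetters g (g + L + 1) (permWord π) ∨ topLetter g N p = N) := by
  rw [excMark_iff]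
  constructor
  · intro h h'
    rw [insWord_self_of_mem π h'] at h
    unfold topLetter at h
    omega
  · intro h
    rw [insWord_self]
    have h1 := leastFrom_spec (B := excLetters g (g + L + 1) (permWord π))
      (topLetter_le (g := g) p)
    have h2 : leastFrom (excLetters g (g + L + 1) (permWord π)) N (topLetter g N p) ≠
        topLetter g N p := fun h2 => h (h2 ▸ h1.1)
    unfold topLetter at *
    omega

/-- Consequently an insertion at place `L` itself always creates an excedance. -/
theorem lt_of_topLetter_mem (hg : 1 ≤ g) (hN : g + L ≤ N) (hp : L ≤ (p : ℕ))
    (π : Equiv.Perm (Fin N))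
    (h : topLetter g N p ∈ excLetters g (g + L + 1) (permWord π) ∨ topLetter g N p = N) :
    L < (p : ℕ) := by
  rcases h with h | h
  · have := le_of_mem_excLetters h
    unfold topLetter at this
    omega
  · unfold topLetter at h
    omega

/-- The increase of the Denert-type statistic caused by inserting place `p`. -/
def insShift (g N : ℕ) (B : Finset ℕ) (p : ℕ) : ℕ :=
  if topLetter g N p ∈ B ∨ topLetter g N p = N then
    topLetter g N p + (B.filter (topLetter g N p ≤ ·)).card - p
  else p + g + (B.filter (topLetter g N p ≤ ·)).card

theorem permDen_insPerm (hg : 1 ≤ g) (hN : g + L ≤ N) (hp : L ≤ (p : ℕ))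
    (π : Equiv.Perm (Fin N)) :
    permDen g (g + L + 1) (insPerm g (g + L + 1) p π) =
    permDen g (g + L + 1) π + insShift g N (excLetters g (g + L + 1) (permWord π)) p := by
  set B := excLetters g (g + L + 1) (permWord π) with hBdef
  set v := topLetter g N p with hv
  have hvN : v ≤ N := topLetter_le p
  have hBN : ∀ x ∈ B, x < N := lt_of_mem_excLetters
  have hmem : ∀ i, excMark g (g + L + 1) (permWord π) i = true ↔ permWord π i ∈ B :=
    fun i => excMark_iff_mem_excLetters (permWord_injective π)
  unfold permDen
  rw [permWord_insPerm, wordDen_insert g p _ _ (excMark g (g + L + 1) (permWord π)) (permWord π)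
    (excMark_insWord_succAbove hg π) ?_]
  · simp only [insWord_succAbove, ← hBdef, ← hv]
    unfold insShift
    rw [← hv, card_filter_excLetters (permWord_injective π)]
    by_cases hb : v ∈ B ∨ v = N
    · have hLp := lt_of_topLetter_mem hg hN hp π hb
      have hE : excMark g (g + L + 1) (insWord g (g + L + 1) p π) p = false := by
        rw [Bool.eq_false_iff, Ne, excMark_insWord_self hg hp]
        exact fun h => h hb
      rw [insWord_self_of_mem π hb, hE, if_pos hb, ← hv]
      have h1 : (∑ i : Fin N, if (i : ℕ) < p then 1 else 0) = (p : ℕ) :=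
        Fin.sum_val_lt (by omega)
      have h2 : (∑ i : Fin N, if permWord π i < v then 1 else 0) = v := by
        have := Fin.sum_val_lt hvN
        rwa [← Equiv.sum_comp π] at this
      -- The inserted letter is `v`, unmarked. As `L < p`, every unmarked letter left of `p` is
      -- below `v`, and the two sides agree letter by letter. The identity also shows that the
      -- subtraction in `insShift` is not truncated.
      have key : (∑ i : Fin N, if excMark g (g + L + 1) (permWord π) i = true ∧ (p : ℕ) ≤ i
            then 1 else 0) +
          ((∑ i : Fin N, if excMark g (g + L + 1) (permWord π) i = false ∧ (i : ℕ) < p ∧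
            v < bumpLetter B N v (permWord π i) then 1 else 0) +
          ∑ i : Fin N, if excMark g (g + L + 1) (permWord π) i = false ∧ (p : ℕ) ≤ i ∧
            bumpLetter B N v (permWord π i) < v then 1 else 0) +
          (∑ i : Fin N, if (i : ℕ) < p then 1 else 0) =
          (∑ i : Fin N, if permWord π i < v then 1 else 0) +
          ∑ i : Fin N, if excMark g (g + L + 1) (permWord π) i = true ∧ v ≤ permWord π i
            then 1 else 0 := by
        rw [← Finset.sum_add_distrib, ← Finset.sum_add_distrib, ← Finset.sum_add_distrib,
          ← Finset.sum_add_distrib]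
        refine Finset.sum_congr rfl fun i _ => ?_
        have hi : permWord π i < N := (π i).2
        have hv' : v = min (p + g - 1) N := hv
        by_cases h : permWord π i ∈ B
        · have h' := excMark_iff.1 ((hmem i).2 h)
          simp only [(hmem i).2 h, true_and, Bool.true_eq_false, false_and, if_false]
          split_ifs <;> omega
        · have h' := mt (hmem i).1 h
          rw [Bool.not_eq_true] at h'
          have h'' := mt excMark_iff.2 (mt (hmem i).1 h)
          simp only [h', true_and, Bool.false_eq_true, false_and, if_false,
            bumpLetter_of_notMem h]
          split_ifs <;> omega
      rw [h1, h2] at key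
      simp only [Bool.false_eq_true, if_false]
      omega
    · have hE := (excMark_insWord_self hg hp π).2 hb
      rw [hE, if_neg hb, insWord_self, ← hBdef, ← hv]
      -- A marked letter counts once exactly when it is at least `v`: left of `p` it then ends above
      -- the inserted letter, and from `p` on, where it always is at least `v`, its place shifts.
      have key : (∑ i : Fin N, if excMark g (g + L + 1) (permWord π) i = true ∧ (p : ℕ) ≤ i
            then 1 else 0) +
          ((∑ i : Fin N, if excMark g (g + L + 1) (permWord π) i = true ∧ (i : ℕ) < p ∧
            leastFrom B N v < bumpLetter B N v (permWord π i) then 1 else 0) +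
          ∑ i : Fin N, if excMark g (g + L + 1) (permWord π) i = true ∧ (p : ℕ) ≤ i ∧
            bumpLetter B N v (permWord π i) < leastFrom B N v then 1 else 0) =
          ∑ i : Fin N, if excMark g (g + L + 1) (permWord π) i = true ∧ v ≤ permWord π i
            then 1 else 0 := by
        rw [← Finset.sum_add_distrib, ← Finset.sum_add_distrib]
        refine Finset.sum_congr rfl fun i _ => ?_
        have hv' : v = min (p + g - 1) N := hv
        by_cases h : permWord π i ∈ B
        · have h' := excMark_iff.1 ((hmem i).2 h)
          simp only [(hmem i).2 h, true_and, leastFrom_lt_bumpLetter_iff hBN hvN h,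
            bumpLetter_lt_leastFrom_iff hBN hvN h]
          split_ifs <;> omega
        · have h' := mt (hmem i).1 h
          simp [h']
      simp only [if_true]
      omega
  · intro i j hij
    rw [insWord_succAbove, insWord_succAbove]
    by_cases h : permWord π i ∈ B
    · rw [bumpLetter_lt_iff hBN h ((hmem j).1 (hij ▸ (hmem i).2 h))]
    · have hj : permWord π j ∉ B := fun hj => h ((hmem i).1 (hij ▸ (hmem j).2 hj))
      rw [bumpLetter_of_notMem h, bumpLetter_of_notMem hj]

/-- All new excedance letters lie in `B ∪ {N}`; since old places keep their status, counting
excedances turns the inclusion into equality. -/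
theorem excLetters_insWord (hg : 1 ≤ g) (hp : L ≤ (p : ℕ))
    (π : Equiv.Perm (Fin N)) :
    excLetters g (g + L + 1) (insWord g (g + L + 1) p π) =
    if excMark g (g + L + 1) (insWord g (g + L + 1) p π) p = true
    then insert N (excLetters g (g + L + 1) (permWord π))
    else (insert N (excLetters g (g + L + 1) (permWord π))).erase
      (insWord g (g + L + 1) p π p) := by
  have hBN : ∀ x ∈ excLetters g (g + L + 1) (permWord π), x < N := lt_of_mem_excLetters
  have hNB : N ∉ excLetters g (g + L + 1) (permWord π) := fun h => lt_irrefl _ (hBN N h)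
  have hself : insWord g (g + L + 1) p π p ∈
      insert N (excLetters g (g + L + 1) (permWord π)) := by
    rw [insWord_self, Finset.mem_insert, or_comm]
    exact (leastFrom_spec (topLetter_le p)).1
  have hmem : ∀ i, excMark g (g + L + 1) (permWord π) i = true →
      insWord g (g + L + 1) p π (p.succAbove i) ∈
        insert N (excLetters g (g + L + 1) (permWord π)) := fun i hi => by
    rw [insWord_succAbove, Finset.mem_insert, or_comm]
    exact bumpLetter_mem hBN ((excMark_iff_mem_excLetters (permWord_injective π)).1 hi)
  have hcard : (excLetters g (g + L + 1) (insWord g (g + L + 1) p π)).card =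
      (if excMark g (g + L + 1) (insWord g (g + L + 1) p π) p = true then 1 else 0) +
        (excLetters g (g + L + 1) (permWord π)).card := by
    rw [card_excLetters (insWord_injective p π), Fin.sum_univ_succAbove _ p,
      card_excLetters (permWord_injective π)]
    congr 1
    exact Finset.sum_congr rfl fun i _ => by rw [excMark_insWord_succAbove hg]
  have hsub : excLetters g (g + L + 1) (insWord g (g + L + 1) p π) ⊆
      insert N (excLetters g (g + L + 1) (permWord π)) := by
    intro x hx
    obtain ⟨j, hj, rfl⟩ := mem_excLetters.1 hx
    obtain rfl | ⟨j, rfl⟩ := Fin.eq_self_or_eq_succAbove p j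
    · exact hself
    · exact hmem j (excMark_insWord_succAbove hg π j ▸ hj)
  split_ifs with h
  · rw [if_pos h] at hcard
    refine Finset.eq_of_subset_of_card_le hsub ?_
    rw [Finset.card_insert_of_notMem hNB]
    omega
  · rw [if_neg h] at hcard
    refine Finset.eq_of_subset_of_card_le (fun x hx => ?_) ?_
    · refine Finset.mem_erase.2 ⟨?_, hsub hx⟩
      rintro rfl
      exact h ((excMark_iff_mem_excLetters (insWord_injective p π)).2 hx)
    · rw [Finset.card_erase_of_mem hself, Finset.card_insert_of_notMem hNB]
      omega

/-- The number of excedance places that are at least `L`. -/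
def tailExc (g t L : ℕ) {n : ℕ} (w : Fin n → ℕ) : ℕ :=
  ∑ i : Fin n, if excMark g t w i = true ∧ L ≤ (i : ℕ) then 1 else 0

/-- From place `L` on, the gap condition already forces the raised level. -/
theorem gapExc_eq_tailExc (g L : ℕ) {n : ℕ} (σ : Equiv.Perm (Fin n)) :
    gapExc g (L + 1) σ = tailExc g (g + L + 1) L (permWord σ) := by
  rw [gapExc_eq_sum, tailExc]
  refine Finset.sum_congr rfl fun i _ => if_congr ?_ rfl rfl
  rw [excMark_iff, permWord]
  omega

theorem tailExc_insWord (hg : 1 ≤ g) (hp : L ≤ (p : ℕ))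
    (π : Equiv.Perm (Fin N)) :
    tailExc g (g + L + 1) L (insWord g (g + L + 1) p π) =
    tailExc g (g + L + 1) L (permWord π) +
      if excMark g (g + L + 1) (insWord g (g + L + 1) p π) p = true then 1 else 0 := by
  rw [tailExc, Fin.sum_univ_succAbove _ p, add_comm, tailExc]
  congr 1
  · refine Finset.sum_congr rfl fun i _ => if_congr ?_ rfl rfl
    rw [excMark_insWord_succAbove hg, Fin.val_succAbove_eq]
    refine and_congr_right fun _ => ?_
    split_ifs <;> omega
  · simp [hp]

end insStat

/-! ### Recovering the inserted place and the original permutation -/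

/-- The condition that identifies the inserted place of `insWord`. -/
def IsSlot (g t : ℕ) {N : ℕ} (s : Fin (N + 1) → ℕ) (p : Fin (N + 1)) : Prop :=
  if excMark g t s p = true then ∀ x ∈ excLetters g t s, (p : ℕ) + g - 1 ≤ x → s p ≤ x
  else s p = topLetter g N p

section slot

variable {g L N : ℕ} {p p' : Fin (N + 1)}

theorem isSlot_insWord (hg : 1 ≤ g) (hp : L ≤ (p : ℕ)) (π : Equiv.Perm (Fin N)) :
    IsSlot g (g + L + 1) (insWord g (g + L + 1) p π) p := by
  unfold IsSlot
  rw [excLetters_insWord hg hp]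
  split_ifs with h
  · intro x hx hpx
    rw [insWord_self]
    refine leastFrom_le (or_comm.1 (Finset.mem_insert.1 hx)) ?_
    unfold topLetter
    omega
  · rw [excMark_insWord_self hg hp, not_not] at h
    exact insWord_self_of_mem π h

/-- At a later excedance place the old letter was bumped, but it is still an excedance letter and
contradicts minimality. At a later place that is not an excedance, the letter is unchanged and below
`topLetter`. -/
theorem not_isSlot_insWord (hg : 1 ≤ g) (hp : L ≤ (p : ℕ)) (hpp : p < p')
    (π : Equiv.Perm (Fin N)) : ¬ IsSlot g (g + L + 1) (insWord g (g + L + 1) p π) p' := by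
  obtain rfl | ⟨i, rfl⟩ := Fin.eq_self_or_eq_succAbove p p'
  · exact absurd hpp (lt_irrefl _)
  have hi : ¬ (i : ℕ) < p := fun h => by
    rw [Fin.lt_def, Fin.val_succAbove_eq, if_pos h] at hpp
    omega
  have hval : ((p.succAbove i : Fin (N + 1)) : ℕ) = i + 1 := by
    rw [Fin.val_succAbove_eq, if_neg hi]
  have hlt : permWord π i < N := (π i).2
  unfold IsSlot
  rw [excMark_insWord_succAbove hg, hval]
  intro h
  split_ifs at h with hm
  · have hB := (excMark_iff_mem_excLetters (permWord_injective π)).1 hm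
    have hm' := excMark_iff.1 hm
    have hmem : permWord π i ∈ excLetters g (g + L + 1) (insWord g (g + L + 1) p π) := by
      rw [excLetters_insWord hg hp]
      split_ifs with h'
      · exact Finset.mem_insert_of_mem hB
      · refine Finset.mem_erase.2 ⟨?_, Finset.mem_insert_of_mem hB⟩
        rw [excMark_insWord_self hg hp, not_not] at h'
        rw [insWord_self_of_mem π h']
        unfold topLetter
        omega
    have h1 := h _ hmem (by omega)
    rw [insWord_succAbove] at h1
    have h2 := lt_bumpLetter (v := topLetter g N p) lt_of_mem_excLetters hB
      (by unfold topLetter; omega)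
    omega
  · rw [insWord_succAbove, bumpLetter_of_notMem
      (mt (excMark_iff_mem_excLetters (permWord_injective π)).2 hm)] at h
    rw [excMark_iff] at hm
    unfold topLetter at h
    omega

theorem insPerm_injective (hg : 1 ≤ g) (hp : L ≤ (p : ℕ)) :
    Function.Injective (insPerm g (g + L + 1) p : Equiv.Perm (Fin N) → _) := by
  intro π ρ h
  have hw : insWord g (g + L + 1) p π = insWord g (g + L + 1) p ρ := by
    rw [← permWord_insPerm, ← permWord_insPerm, h]
  -- The set `B` can be read off from the new word; then injectivity of the bump recovers the
  -- letters.
  have hins : ∀ π : Equiv.Perm (Fin N), insert N (excLetters g (g + L + 1) (permWord π)) =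
      insert (insWord g (g + L + 1) p π p)
        (insert N (excLetters g (g + L + 1) (insWord g (g + L + 1) p π))) := fun π => by
    have hself : insWord g (g + L + 1) p π p ∈
        insert N (excLetters g (g + L + 1) (permWord π)) := by
      rw [insWord_self, Finset.mem_insert, or_comm]
      exact (leastFrom_spec (topLetter_le p)).1
    rw [excLetters_insWord hg hp]
    ext x
    split_ifs with h <;> simp only [Finset.mem_insert, Finset.mem_erase] at hself ⊢
    · constructor
      · tauto
      · rintro (rfl | h | h | h) <;> tauto
    · constructor
      · tauto
      · rintro (rfl | h | h) <;> tauto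
  have hB : excLetters g (g + L + 1) (permWord π) = excLetters g (g + L + 1) (permWord ρ) := by
    have h1 : ∀ π : Equiv.Perm (Fin N), N ∉ excLetters g (g + L + 1) (permWord π) :=
      fun π h => lt_irrefl _ (lt_of_mem_excLetters N h)
    rw [← Finset.erase_insert (h1 π), ← Finset.erase_insert (h1 ρ), hins π, hins ρ, hw]
  refine permWord_inj (funext fun i => ?_)
  have hi := congrFun hw (p.succAbove i)
  rw [insWord_succAbove, insWord_succAbove, hB] at hi
  exact bumpLetter_injOn lt_of_mem_excLetters (π i).2 (ρ i).2 hi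

end slot

/-! ### The first `L + 1` places as ordinary inversions of keys -/

/-- A key that orders the letters below `n` so that the letters `≥ b` come first. -/
def letterKey (b n x : ℕ) : ℕ := if b ≤ x then x else x + n

theorem letterKey_inj {b n x y : ℕ} (hx : x < n) (hy : y < n)
    (h : letterKey b n x = letterKey b n y) : x = y := by
  unfold letterKey at h
  split_ifs at h <;> omega

/-- The number of inversions of the keys within the places `≤ L`. -/
def keyInv (b L : ℕ) {n : ℕ} (w : Fin n → ℕ) : ℕ :=
  ∑ i : Fin n, ∑ j : Fin n,
    if i < j ∧ (j : ℕ) ≤ L ∧ letterKey b n (w j) < letterKey b n (w i) then 1 else 0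

/-- The number of excedance places that are at most `L`. -/
def headExc (g t L : ℕ) {n : ℕ} (w : Fin n → ℕ) : ℕ :=
  ∑ i : Fin n, if excMark g t w i = true ∧ (i : ℕ) ≤ L then 1 else 0

/-- The part of the Denert-type statistic that does not depend on the order of the first
`L + 1` letters. -/
def denRest (g t L : ℕ) {n : ℕ} (w : Fin n → ℕ) : ℕ :=
  (∑ i : Fin n, if excMark g t w i = true then (if (i : ℕ) ≤ L then g else i + g) else 0) +
  ∑ i : Fin n, ∑ j : Fin n, if L < (j : ℕ) ∧ ((i : ℕ) ≤ L ∨ i < j) ∧ w j < w i ∧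
    excMark g t w i = excMark g t w j then 1 else 0

theorem Finset.sum_indicator_sq {n : ℕ} (f : Fin n → Prop) [DecidablePred f] :
    (∑ i, if f i then 1 else 0) * (∑ i, if f i then 1 else 0) =
      (∑ i, if f i then 1 else 0) + 2 * ∑ i, ∑ j, if i < j ∧ f i ∧ f j then 1 else 0 := by
  have h : ∀ i j : Fin n, (if f i then 1 else 0) * (if f j then 1 else 0) =
      (if i = j then (if f i then 1 else 0) else 0) + (if i < j ∧ f i ∧ f j then 1 else 0) +
        if j < i ∧ f j ∧ f i then 1 else 0 := fun i j => by
    rcases lt_trichotomy i j with h | rfl | h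
    · by_cases h1 : f i <;> by_cases h2 : f j <;> simp [h, h.ne, h.asymm, h1, h2]
    · by_cases h1 : f i <;> simp [h1]
    · by_cases h1 : f i <;> by_cases h2 : f j <;> simp [h, h.ne', h.asymm, h1, h2]
  rw [Finset.sum_mul_sum]
  simp only [h, Finset.sum_add_distrib]
  rw [Finset.sum_comm (f := fun i j => if j < i ∧ f j ∧ f i then 1 else 0)]
  simp only [Finset.sum_ite_eq, Finset.mem_univ, if_true]
  ring

/-- With `h = headExc`, this says that the statistic is `keyInv + denRest + h (h - 1) / 2`; doubling
avoids the division. -/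
theorem two_mul_permDen {g L n : ℕ} (π : Equiv.Perm (Fin n)) :
    2 * permDen g (g + L + 1) π + headExc g (g + L + 1) L (permWord π) =
      2 * (keyInv (g + L) L (permWord π) + denRest g (g + L + 1) L (permWord π)) +
        headExc g (g + L + 1) L (permWord π) * headExc g (g + L + 1) L (permWord π) := by
  have h1 := Finset.sum_indicator_sq
    (fun i : Fin n => excMark g (g + L + 1) (permWord π) i = true ∧ (i : ℕ) ≤ L)
  change headExc g (g + L + 1) L (permWord π) * headExc g (g + L + 1) L (permWord π) =
    headExc g (g + L + 1) L (permWord π) + _ at h1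
  -- A place number is the number of places before it, so the excedance places up to `L` contribute
  -- a count of pairs.
  have h2 : (∑ i : Fin n, if excMark g (g + L + 1) (permWord π) i = true then (i : ℕ) + g
        else 0) =
      (∑ i : Fin n, if excMark g (g + L + 1) (permWord π) i = true then
        (if (i : ℕ) ≤ L then g else i + g) else 0) +
      ∑ i : Fin n, ∑ j : Fin n, if i < j ∧ excMark g (g + L + 1) (permWord π) j = true ∧
        (j : ℕ) ≤ L then 1 else 0 := by
    rw [Finset.sum_comm, ← Finset.sum_add_distrib]
    refine Finset.sum_congr rfl fun i _ => ?_
    by_cases h : excMark g (g + L + 1) (permWord π) i = true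
    · by_cases hi : (i : ℕ) ≤ L
      · have := Fin.sum_val_lt (n := n) (v := i) i.2.le
        simp only [Fin.val_fin_lt] at this
        simp only [h, hi, and_true, if_true, this]
        omega
      · simp [h, hi]
    · simp [h]
  -- For `i < j ≤ L` with only `j` marked, the pair from `h2` is the key inversion, because marked
  -- letters have the smaller keys. With both marked, the extra pair is counted in `h (h - 1) / 2`.
  have h3 : (∑ i : Fin n, ∑ j : Fin n, if i < j ∧
          excMark g (g + L + 1) (permWord π) j = true ∧ (j : ℕ) ≤ L then 1 else 0) +
        (∑ i, ∑ j, if i < j ∧ permWord π j < permWord π i ∧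
          excMark g (g + L + 1) (permWord π) i = excMark g (g + L + 1) (permWord π) j
            then 1 else 0) =
      (∑ i : Fin n, ∑ j : Fin n, if i < j ∧ (j : ℕ) ≤ L ∧ letterKey (g + L) n (permWord π j) <
        letterKey (g + L) n (permWord π i) then 1 else 0) +
      ((∑ i : Fin n, ∑ j : Fin n, if i < j ∧ (excMark g (g + L + 1) (permWord π) i = true ∧
        (i : ℕ) ≤ L) ∧ (excMark g (g + L + 1) (permWord π) j = true ∧ (j : ℕ) ≤ L)
          then 1 else 0) +
      ∑ i : Fin n, ∑ j : Fin n, if L < (j : ℕ) ∧ ((i : ℕ) ≤ L ∨ i < j) ∧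
        permWord π j < permWord π i ∧
        excMark g (g + L + 1) (permWord π) i = excMark g (g + L + 1) (permWord π) j
          then 1 else 0) := by
    simp only [← Finset.sum_add_distrib]
    refine Finset.sum_congr rfl fun i _ => Finset.sum_congr rfl fun j _ => ?_
    have hwi : permWord π i < n := (π i).2
    have hwj : permWord π j < n := (π j).2
    have hi := excMark_iff (g := g) (t := g + L + 1) (w := permWord π) (i := i)
    have hj := excMark_iff (g := g) (t := g + L + 1) (w := permWord π) (i := j)
    unfold letterKey
    simp only [Fin.lt_def]
    by_cases hjL : (j : ℕ) ≤ L
    · by_cases hij : (i : ℕ) < j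
      · cases h : excMark g (g + L + 1) (permWord π) i <;>
          cases h' : excMark g (g + L + 1) (permWord π) j <;>
          simp only [h, h', hjL, hij, true_iff, Bool.false_eq_true, Bool.true_eq_false, false_iff,
            true_and, and_true, false_and, and_false, if_true, if_false] at hi hj ⊢ <;>
          split_ifs <;> omega
      · simp [hjL, hij]
    · by_cases hij : (i : ℕ) < j
      · simp [hjL, hij, not_le.1 hjL]
      · simp [hjL, hij]
        omega
  unfold permDen wordDen keyInv denRest
  omega

/-! ### Invariance under permuting the first `L + 1` places -/

section window

variable {g L n : ℕ} {τ : Equiv.Perm (Fin n)}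

theorem val_le_iff_of_window (hτ : ∀ i : Fin n, L < (i : ℕ) → τ i = i)
    (hτ' : ∀ i : Fin n, (i : ℕ) ≤ L → (τ i : ℕ) ≤ L) (i : Fin n) :
    (τ i : ℕ) ≤ L ↔ (i : ℕ) ≤ L := by
  refine ⟨fun h => ?_, hτ' i⟩
  by_contra hi
  rw [hτ i (by omega)] at h
  exact hi h

theorem excMark_window (hτ : ∀ i : Fin n, L < (i : ℕ) → τ i = i)
    (hτ' : ∀ i : Fin n, (i : ℕ) ≤ L → (τ i : ℕ) ≤ L) (π : Equiv.Perm (Fin n)) (i : Fin n) :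
    excMark g (g + L + 1) (permWord (τ.trans π)) i =
    excMark g (g + L + 1) (permWord π) (τ i) := by
  rw [Bool.eq_iff_iff, excMark_iff, excMark_iff]
  change _ ∧ _ ≤ permWord π (τ i) + 1 ↔ _
  change _ ≤ permWord π (τ i) ∧ _ ↔ _
  by_cases hi : (i : ℕ) ≤ L
  · have := hτ' i hi
    omega
  · rw [hτ i (by omega)]

theorem headExc_window (hτ : ∀ i : Fin n, L < (i : ℕ) → τ i = i)
    (hτ' : ∀ i : Fin n, (i : ℕ) ≤ L → (τ i : ℕ) ≤ L) (π : Equiv.Perm (Fin n)) :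
    headExc g (g + L + 1) L (permWord (τ.trans π)) =
    headExc g (g + L + 1) L (permWord π) := by
  unfold headExc
  refine Eq.trans ?_ (Equiv.sum_comp τ _)
  refine Finset.sum_congr rfl fun i _ => if_congr ?_ rfl rfl
  rw [excMark_window hτ hτ', val_le_iff_of_window hτ hτ']

theorem excLetters_window (hτ : ∀ i : Fin n, L < (i : ℕ) → τ i = i)
    (hτ' : ∀ i : Fin n, (i : ℕ) ≤ L → (τ i : ℕ) ≤ L) (π : Equiv.Perm (Fin n)) :
    excLetters g (g + L + 1) (permWord (τ.trans π)) =
    excLetters g (g + L + 1) (permWord π) := by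
  ext x
  rw [mem_excLetters, mem_excLetters]
  constructor
  · rintro ⟨i, hi, rfl⟩
    exact ⟨τ i, excMark_window hτ hτ' π i ▸ hi, rfl⟩
  · rintro ⟨i, hi, rfl⟩
    refine ⟨τ.symm i, ?_, ?_⟩
    · rwa [excMark_window hτ hτ', Equiv.apply_symm_apply]
    · simp [permWord]

theorem denRest_window (hτ : ∀ i : Fin n, L < (i : ℕ) → τ i = i)
    (hτ' : ∀ i : Fin n, (i : ℕ) ≤ L → (τ i : ℕ) ≤ L) (π : Equiv.Perm (Fin n)) :
    denRest g (g + L + 1) L (permWord (τ.trans π)) =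
    denRest g (g + L + 1) L (permWord π) := by
  have hc : ∀ i j : Fin n, L < (j : ℕ) → (((i : ℕ) ≤ L ∨ i < j) ↔
      (((τ i : Fin n) : ℕ) ≤ L ∨ τ i < τ j)) := fun i j hj => by
    rw [val_le_iff_of_window hτ hτ', hτ j hj]
    by_cases hi : (i : ℕ) ≤ L
    · simp [hi]
    · rw [hτ i (by omega)]
  unfold denRest
  congr 1
  · rw [← Equiv.sum_comp τ (fun i => if excMark g (g + L + 1) (permWord π) i = true then _
      else 0)]
    refine Finset.sum_congr rfl fun i _ => ?_
    rw [excMark_window hτ hτ']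
    by_cases hi : (i : ℕ) ≤ L
    · simp [hi, hτ' i hi]
    · rw [hτ i (by omega)]
  · rw [← Equiv.sum_comp τ (fun i => ∑ j : Fin n, if L < (j : ℕ) ∧ ((i : ℕ) ≤ L ∨ i < j) ∧
      permWord π j < permWord π i ∧ excMark g (g + L + 1) (permWord π) i =
        excMark g (g + L + 1) (permWord π) j then 1 else 0)]
    refine Finset.sum_congr rfl fun i _ => ?_
    refine Eq.trans ?_ (Equiv.sum_comp τ _)
    refine Finset.sum_congr rfl fun j _ => if_congr ?_ rfl rfl
    rw [excMark_window hτ hτ', excMark_window hτ hτ', ← not_le (b := L), ← not_le (b := L),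
      val_le_iff_of_window hτ hτ' j, not_le]
    refine and_congr_right fun hj => ?_
    rw [hc i j hj]
    rfl

end window

/-! ### Exchanging the letter at place `ℓ` (formerly `L`) with the next key -/

/-- The place `a < ℓ` carries the letter with the next larger key after the letter at place `ℓ`
among the places up to `ℓ`. -/
def IsNextKey (b : ℕ) {n : ℕ} (ℓ : Fin n) (w : Fin n → ℕ) (a : Fin n) : Prop :=
  a < ℓ ∧ letterKey b n (w ℓ) < letterKey b n (w a) ∧
    ∀ j ≤ ℓ, letterKey b n (w j) ≤ letterKey b n (w ℓ) ∨
      letterKey b n (w a) ≤ letterKey b n (w j)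

/-- The number of places before `ℓ` with a smaller key than place `ℓ`. -/
def keyRank (b : ℕ) {n : ℕ} (ℓ : Fin n) (w : Fin n → ℕ) : ℕ :=
  (Finset.univ.filter fun i => i < ℓ ∧ letterKey b n (w i) < letterKey b n (w ℓ)).card

open Classical in
/-- Exchange the letter at place `ℓ` with the letter of next larger key. -/
noncomputable def raiseKey (b : ℕ) {n : ℕ} (ℓ : Fin n) (π : Equiv.Perm (Fin n)) :
    Equiv.Perm (Fin n) :=
  if h : ∃ a, IsNextKey b ℓ (permWord π) a then (Equiv.swap h.choose ℓ).trans π else π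

section raise

variable {b n : ℕ} {ℓ : Fin n}

theorem exists_isNextKey (π : Equiv.Perm (Fin n)) (h : keyRank b ℓ (permWord π) < ℓ) :
    ∃ a, IsNextKey b ℓ (permWord π) a := by
  have hne : (Finset.univ.filter fun i : Fin n => i < ℓ ∧
      letterKey b n (permWord π ℓ) < letterKey b n (permWord π i)).Nonempty := by
    by_contra hemp
    rw [Finset.not_nonempty_iff_eq_empty, Finset.filter_eq_empty_iff] at hemp
    have hall : keyRank b ℓ (permWord π) = ℓ := by
      rw [keyRank, ← Fin.card_Iio ℓ]
      congr 1
      ext i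
      simp only [Finset.mem_filter, Finset.mem_univ, true_and, Finset.mem_Iio]
      refine ⟨fun h => h.1, fun hi => ⟨hi, ?_⟩⟩
      refine lt_of_le_of_ne (not_lt.1 fun h' => hemp (Finset.mem_univ i) ⟨hi, h'⟩) fun h' => ?_
      exact hi.ne (permWord_injective π (letterKey_inj (π i).2 (π ℓ).2 h'))
    omega
  obtain ⟨a, ha, hmin⟩ := Finset.exists_min_image _
    (fun i => letterKey b n (permWord π i)) hne
  simp only [Finset.mem_filter, Finset.mem_univ, true_and] at ha hmin
  refine ⟨a, ha.1, ha.2, fun j hj => ?_⟩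
  by_contra! hcon
  rcases hj.lt_or_eq with hj | rfl
  · exact absurd (hmin j ⟨hj, hcon.1⟩) (by omega)
  · exact absurd hcon.1 (lt_irrefl _)

theorem raiseKey_spec (π : Equiv.Perm (Fin n)) (h : ∃ a, IsNextKey b ℓ (permWord π) a) :
    ∃ a, IsNextKey b ℓ (permWord π) a ∧ raiseKey b ℓ π = (Equiv.swap a ℓ).trans π :=
  ⟨h.choose, h.choose_spec, by rw [raiseKey, dif_pos h]⟩

theorem permWord_swap_trans (π : Equiv.Perm (Fin n)) (a i : Fin n) :
    permWord ((Equiv.swap a ℓ).trans π) i =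
      if i = a then permWord π ℓ else if i = ℓ then permWord π a else permWord π i := by
  rw [permWord, Equiv.trans_apply, Equiv.swap_apply_def]
  split_ifs <;> rfl

/-- After the exchange, place `a` carries the next smaller key before that of place `ℓ`, among the
places up to `ℓ`, so `a` can be read off. -/
theorem raiseKey_injective {π ρ : Equiv.Perm (Fin n)}
    (hπ : ∃ a, IsNextKey b ℓ (permWord π) a) (hρ : ∃ a, IsNextKey b ℓ (permWord ρ) a)
    (h : raiseKey b ℓ π = raiseKey b ℓ ρ) : π = ρ := by
  obtain ⟨a, ha, ha'⟩ := raiseKey_spec π hπ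
  obtain ⟨c, hc, hc'⟩ := raiseKey_spec ρ hρ
  rw [ha', hc'] at h
  have hw : ∀ i, permWord ((Equiv.swap a ℓ).trans π) i =
      permWord ((Equiv.swap c ℓ).trans ρ) i := fun i => by rw [h]
  simp only [permWord_swap_trans] at hw
  have hac : a = c := by
    by_contra hne
    have haℓ := ha.1.ne
    have hcℓ := hc.1.ne
    have e1 := hw a
    have e2 := hw c
    have e3 := hw ℓ
    simp only [if_true, hne, Ne.symm hne, if_false, haℓ, hcℓ, haℓ.symm, hcℓ.symm] at e1 e2 e3
    have h1 := ha.2.2 c hc.1.le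
    have h2 := hc.2.2 a ha.1.le
    have h3 := ha.2.1
    have h4 := hc.2.1
    rw [← e1, ← e3] at h2
    rw [e2] at h1
    rw [← e3] at h4
    have h5 : letterKey b n (permWord π ℓ) = letterKey b n (permWord ρ ℓ) := by omega
    have h6 : permWord π ℓ = permWord ρ ℓ := letterKey_inj (π ℓ).2 (ρ ℓ).2 h5
    rw [e1] at h6
    exact haℓ (permWord_injective ρ h6)
  subst hac
  refine Equiv.ext fun i => ?_
  have := congrArg (fun σ : Equiv.Perm (Fin n) => σ (Equiv.swap a ℓ i)) h
  simpa using this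

theorem keyRank_raiseKey (π : Equiv.Perm (Fin n)) (h : ∃ a, IsNextKey b ℓ (permWord π) a) :
    keyRank b ℓ (permWord (raiseKey b ℓ π)) = keyRank b ℓ (permWord π) + 1 := by
  obtain ⟨a, ha, ha'⟩ := raiseKey_spec π h
  rw [ha', keyRank, keyRank]
  have : (Finset.univ.filter fun i => i < ℓ ∧
      letterKey b n (permWord ((Equiv.swap a ℓ).trans π) i) <
        letterKey b n (permWord ((Equiv.swap a ℓ).trans π) ℓ)) =
      insert a (Finset.univ.filter fun i => i < ℓ ∧
        letterKey b n (permWord π i) < letterKey b n (permWord π ℓ)) := by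
    ext i
    simp only [Finset.mem_filter, Finset.mem_univ, true_and, Finset.mem_insert,
      permWord_swap_trans, ha.1.ne', if_true, if_false]
    by_cases hia : i = a
    · simp [hia, ha.1, ha.2.1]
    · by_cases hi : i < ℓ
      · have h1 := ha.2.2 i hi.le
        have h2 : letterKey b n (permWord π i) ≠ letterKey b n (permWord π ℓ) := fun h' =>
          hi.ne (permWord_injective π (letterKey_inj (π i).2 (π ℓ).2 h'))
        have h3 := ha.2.1
        simp only [hia, hi, hi.ne, if_false, true_and, false_or]
        omega
      · simp [hi, hia]
  rw [this, Finset.card_insert_of_notMem]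
  simp only [Finset.mem_filter, Finset.mem_univ, true_and, not_and, not_lt]
  exact fun _ => ha.2.1.le

/-- The two exchanged keys are adjacent among the places up to `ℓ`, so only their mutual comparison
changes. -/
theorem keyInv_raiseKey (π : Equiv.Perm (Fin n)) (h : ∃ a, IsNextKey b ℓ (permWord π) a) :
    keyInv b ℓ (permWord (raiseKey b ℓ π)) + 1 = keyInv b ℓ (permWord π) := by
  obtain ⟨a, ha, ha'⟩ := raiseKey_spec π h
  rw [ha']
  have hcard : ∀ w : Fin n → ℕ, keyInv b ℓ w =
      (Finset.univ.filter fun x : Fin n × Fin n => x.1 < x.2 ∧ x.2 ≤ ℓ ∧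
        letterKey b n (w x.2) < letterKey b n (w x.1)).card := fun w => by
    rw [Finset.card_filter, Fintype.sum_prod_type, keyInv]
    rfl
  rw [hcard, hcard]
  have hmem : (a, ℓ) ∈ (Finset.univ.filter fun x : Fin n × Fin n => x.1 < x.2 ∧ x.2 ≤ ℓ ∧
        letterKey b n (permWord π x.2) < letterKey b n (permWord π x.1)) := by
    simp [ha.1, ha.2.1]
  rw [← Finset.card_erase_add_one hmem]
  congr 2
  ext ⟨i, j⟩
  simp only [Finset.mem_filter, Finset.mem_univ, true_and, Finset.mem_erase, Prod.mk.injEq,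
    ne_eq]
  rcases lt_or_ge i j with hij | hij
  swap
  · simp [hij.not_gt]
  rcases lt_or_ge ℓ j with hj | hj
  · simp [hj.not_ge]
  have hi : i ≤ ℓ := hij.le.trans hj
  have h1 := ha.2.2 i hi
  have h2 := ha.2.2 j hj
  have h3 := ha.2.1
  have hk : ∀ {x y : Fin n}, x ≠ y →
      letterKey b n (permWord π x) ≠ letterKey b n (permWord π y) := fun {x y} hne h' =>
    hne (permWord_injective π (letterKey_inj (π x).2 (π y).2 h'))
  have hiℓ : i ≠ ℓ := fun h' => by subst h'; exact absurd hij hj.not_gt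
  simp only [hij, hj, true_and, permWord_swap_trans, hiℓ, if_false]
  by_cases hia : i = a
  · subst hia
    by_cases hjℓ : j = ℓ
    · subst hjℓ
      simp [hij.ne', h3.le]
    · have h4 := hk hij.ne'
      have h5 := hk hjℓ
      simp only [hij.ne', hjℓ, if_true, if_false, and_false, not_false_eq_true, true_and]
      omega
  · have h4 := hk hia
    have h5 := hk hiℓ
    by_cases hja : j = a
    · subst hja
      simp only [hia, if_true, if_false, false_and, not_false_eq_true, true_and]
      omega
    · by_cases hjℓ : j = ℓ
      · subst hjℓ
        simp only [hia, hja, if_true, if_false, false_and, not_false_eq_true, true_and]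
        omega
      · simp only [hia, hja, hjℓ, if_false, false_and, not_false_eq_true, true_and]

end raise

section raiseStat

variable {g n : ℕ} {ℓ : Fin n}

theorem swap_fix_of_lt {a ℓ i : Fin n} (ha : a < ℓ) (hi : (ℓ : ℕ) < i) :
    Equiv.swap a ℓ i = i := by
  refine Equiv.swap_apply_of_ne_of_ne ?_ ?_ <;> rintro rfl
  · exact absurd ha (by rw [Fin.lt_def]; omega)
  · exact lt_irrefl _ hi

theorem swap_val_le {a ℓ i : Fin n} (ha : a < ℓ) (hi : (i : ℕ) ≤ ℓ) :
    (Equiv.swap a ℓ i : ℕ) ≤ ℓ := by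
  rw [Equiv.swap_apply_def]
  rw [Fin.lt_def] at ha
  split_ifs <;> omega

/-- Two permutations agree except for the order of the letters at the places up to `ℓ`. -/
structure SameTail (g : ℕ) (ℓ : Fin n) (π ρ : Equiv.Perm (Fin n)) : Prop where
  head : headExc g (g + ℓ + 1) ℓ (permWord π) = headExc g (g + ℓ + 1) ℓ (permWord ρ)
  letters : excLetters g (g + ℓ + 1) (permWord π) = excLetters g (g + ℓ + 1) (permWord ρ)
  tail : ∀ i, ℓ < i → permWord π i = permWord ρ i

theorem sameTail_raiseKey (π : Equiv.Perm (Fin n))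
    (h : ∃ a, IsNextKey (g + ℓ) ℓ (permWord π) a) : SameTail g ℓ (raiseKey (g + ℓ) ℓ π) π := by
  obtain ⟨a, ha, ha'⟩ := raiseKey_spec π h
  rw [ha']
  have h1 := fun i => swap_fix_of_lt (i := i) ha.1
  have h2 := fun i => swap_val_le (i := i) ha.1
  refine ⟨headExc_window h1 h2 π, excLetters_window h1 h2 π, fun i hi => ?_⟩
  rw [permWord, Equiv.trans_apply, h1 i hi, permWord]

theorem permDen_raiseKey (π : Equiv.Perm (Fin n))
    (h : ∃ a, IsNextKey (g + ℓ) ℓ (permWord π) a) :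
    permDen g (g + ℓ + 1) (raiseKey (g + ℓ) ℓ π) + 1 = permDen g (g + ℓ + 1) π := by
  have h3 := keyInv_raiseKey π h
  have h4 := (sameTail_raiseKey π h).head
  obtain ⟨a, ha, ha'⟩ := raiseKey_spec π h
  have h5 : denRest g (g + ℓ + 1) ℓ (permWord (raiseKey (g + ℓ) ℓ π)) =
      denRest g (g + ℓ + 1) ℓ (permWord π) := by
    rw [ha']
    exact denRest_window (fun i => swap_fix_of_lt (i := i) ha.1)
      (fun i => swap_val_le (i := i) ha.1) π
  have h6 := two_mul_permDen (g := g) (L := ℓ) π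
  have h7 := two_mul_permDen (g := g) (L := ℓ) (raiseKey (g + ℓ) ℓ π)
  rw [h4, h5] at h7
  omega

theorem raiseKey_iterate {π : Equiv.Perm (Fin n)} (hπ : keyRank (g + ℓ) ℓ (permWord π) = 0)
    {k : ℕ} (hk : k ≤ ℓ) :
    SameTail g ℓ ((raiseKey (g + ℓ) ℓ)^[k] π) π ∧
      permDen g (g + ℓ + 1) ((raiseKey (g + ℓ) ℓ)^[k] π) + k = permDen g (g + ℓ + 1) π ∧
      keyRank (g + ℓ) ℓ (permWord ((raiseKey (g + ℓ) ℓ)^[k] π)) = k := by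
  induction k with
  | zero => exact ⟨⟨rfl, rfl, fun _ _ => rfl⟩, rfl, hπ⟩
  | succ k ih =>
    obtain ⟨h1, h2, h3⟩ := ih (by omega)
    rw [Function.iterate_succ_apply']
    have hex := exists_isNextKey (b := g + ℓ) (ℓ := ℓ) ((raiseKey (g + ℓ) ℓ)^[k] π) (by omega)
    have h4 := sameTail_raiseKey _ hex
    refine ⟨⟨h4.head.trans h1.head, h4.letters.trans h1.letters,
      fun i hi => (h4.tail i hi).trans (h1.tail i hi)⟩, ?_, ?_⟩
    · have := permDen_raiseKey _ hex
      omega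
    · rw [keyRank_raiseKey _ hex, h3]

theorem raiseKey_iterate_injective {π ρ : Equiv.Perm (Fin n)}
    (hπ : keyRank (g + ℓ) ℓ (permWord π) = 0) (hρ : keyRank (g + ℓ) ℓ (permWord ρ) = 0)
    {k : ℕ} (hk : k ≤ ℓ) (h : (raiseKey (g + ℓ) ℓ)^[k] π = (raiseKey (g + ℓ) ℓ)^[k] ρ) :
    π = ρ := by
  induction k with
  | zero => exact h
  | succ k ih =>
    rw [Function.iterate_succ_apply', Function.iterate_succ_apply'] at h
    have h1 := (raiseKey_iterate (k := k) hπ (by omega)).2.2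
    have h2 := (raiseKey_iterate (k := k) hρ (by omega)).2.2
    exact ih (by omega) (raiseKey_injective (exists_isNextKey _ (by omega))
      (exists_isNextKey _ (by omega)) h)

/-- Among the places up to `ℓ`, the excedance letters are those that are at least `g + ℓ`, and these
have the smallest keys. -/
theorem excMark_iff_keyRank_lt (π : Equiv.Perm (Fin n)) :
    excMark g (g + ℓ + 1) (permWord π) ℓ = true ↔
      keyRank (g + ℓ) ℓ (permWord π) < headExc g (g + ℓ + 1) ℓ (permWord π) := by
  have hmark : ∀ i : Fin n, (i : ℕ) ≤ ℓ →
      (excMark g (g + ℓ + 1) (permWord π) i = true ↔ g + ℓ ≤ permWord π i) := fun i hi => by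
    rw [excMark_iff]; omega
  have hhead : headExc g (g + ℓ + 1) ℓ (permWord π) = (Finset.univ.filter fun i : Fin n =>
      excMark g (g + ℓ + 1) (permWord π) i = true ∧ (i : ℕ) ≤ ℓ).card := by
    rw [headExc, Finset.card_filter]
  rw [hhead, keyRank]
  have hlt : ∀ i, permWord π i < n := fun i => (π i).2
  constructor
  · intro h
    refine Finset.card_lt_card (Finset.ssubset_iff.2 ⟨ℓ, by simp, ?_⟩)
    intro i hi
    simp only [Finset.mem_insert, Finset.mem_filter, Finset.mem_univ, true_and] at hi ⊢
    rcases hi with rfl | hi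
    · exact ⟨h, le_rfl⟩
    · have h1 := (hmark ℓ le_rfl).1 h
      have h2 := hi.1.le
      rw [Fin.le_def] at h2
      refine ⟨(hmark i h2).2 ?_, h2⟩
      have h3 := hi.2
      have := hlt ℓ
      unfold letterKey at h3
      split_ifs at h3 <;> omega
  · intro h
    by_contra h'
    refine absurd h (not_lt.2 (Finset.card_le_card fun i hi => ?_))
    simp only [Finset.mem_filter, Finset.mem_univ, true_and] at hi ⊢
    have hne : i ≠ ℓ := by rintro rfl; exact h' hi.1
    refine ⟨lt_of_le_of_ne (Fin.le_def.2 hi.2) hne, ?_⟩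
    have h1 := (hmark i hi.2).1 hi.1
    have h2 := mt (hmark ℓ le_rfl).2 h'
    have := hlt i
    unfold letterKey
    split_ifs
    omega

theorem tailExc_add_headExc (π : Equiv.Perm (Fin n)) :
    tailExc g (g + ℓ + 1) ℓ (permWord π) + headExc g (g + ℓ + 1) ℓ (permWord π) =
      (excLetters g (g + ℓ + 1) (permWord π)).card +
        if excMark g (g + ℓ + 1) (permWord π) ℓ = true then 1 else 0 := by
  rw [tailExc, headExc, card_excLetters (permWord_injective π)]
  have : (if excMark g (g + ℓ + 1) (permWord π) ℓ = true then 1 else 0) =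
      ∑ i, if i = ℓ then (if excMark g (g + ℓ + 1) (permWord π) i = true then 1 else 0)
        else 0 := by simp
  rw [this, ← Finset.sum_add_distrib, ← Finset.sum_add_distrib]
  refine Finset.sum_congr rfl fun i _ => ?_
  by_cases h : excMark g (g + ℓ + 1) (permWord π) i = true
  · simp only [h, true_and, if_true, Fin.ext_iff]
    split_ifs <;> omega
  · simp [h]

end raiseStat

/-! ### The `N + 1` enlargements of a permutation -/

section option

variable {g N : ℕ} {ℓ : Fin (N + 1)}

/-- The letter inserted at `ℓ` is the smallest excedance letter, so its key is least and all `ℓ`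
exchanges remain available. -/
theorem keyRank_insPerm (hg : 1 ≤ g) (hN : g + ℓ ≤ N) (π : Equiv.Perm (Fin N)) :
    keyRank (g + ℓ) ℓ (permWord (insPerm g (g + ℓ + 1) ℓ π)) = 0 := by
  rw [keyRank, Finset.card_eq_zero, Finset.filter_eq_empty_iff, permWord_insPerm]
  rintro i - ⟨hi, h⟩
  have hinj := insWord_injective (g := g) (t := g + ℓ + 1) ℓ π
  have hne := hinj.ne hi.ne
  have hm : excMark g (g + ℓ + 1) (insWord g (g + ℓ + 1) ℓ π) ℓ = true := by
    rw [excMark_insWord_self hg le_rfl]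
    exact fun h => lt_irrefl _ (lt_of_topLetter_mem hg hN le_rfl π h)
  have h1 := excMark_iff.1 hm
  have h2 := insWord_lt (g := g) (t := g + ℓ + 1) ℓ π i
  have h3 := insWord_lt (g := g) (t := g + ℓ + 1) ℓ π ℓ
  rw [Fin.lt_def] at hi
  unfold letterKey at h
  have hpos : g + ℓ ≤ insWord g (g + ℓ + 1) ℓ π ℓ := by omega
  simp only [if_pos hpos] at h
  split_ifs at h
  · have h4 : insWord g (g + ℓ + 1) ℓ π i ∈
        excLetters g (g + ℓ + 1) (insWord g (g + ℓ + 1) ℓ π) :=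
      (excMark_iff_mem_excLetters hinj).1 (excMark_iff.2 (by omega))
    have h5 := isSlot_insWord hg (le_refl (ℓ : ℕ)) π
    rw [IsSlot, if_pos hm] at h5
    have := h5 _ h4 (by omega)
    omega
  · omega

/-- The `N + 1` ways of enlarging `π`: insertion at a place after `ℓ`, or insertion at `ℓ`
followed by an exchange with one of the letters up to `ℓ`. -/
noncomputable def enlarge (g : ℕ) (ℓ : Fin (N + 1)) (π : Equiv.Perm (Fin N)) (o : Fin (N + 1)) :
    Equiv.Perm (Fin (N + 1)) :=
  if o ≤ ℓ then (raiseKey (g + ℓ) ℓ)^[o] (insPerm g (g + ℓ + 1) ℓ π)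
  else insPerm g (g + ℓ + 1) o π

/-- Options up to `ℓ` are told apart by `keyRank`. A later option is the last slot, and exchanges
create no slot after `ℓ`, since they keep the excedance letters and all letters after `ℓ`. -/
theorem enlarge_injective (hg : 1 ≤ g) (hN : g + ℓ ≤ N) :
    Function.Injective fun x : Equiv.Perm (Fin N) × Fin (N + 1) => enlarge g ℓ x.1 x.2 := by
  have key : ∀ (π ρ : Equiv.Perm (Fin N)) (o p : Fin (N + 1)), o < p →
      enlarge g ℓ π o ≠ enlarge g ℓ ρ p := fun π ρ o p hop h => by
    unfold enlarge at h
    by_cases hp : p ≤ ℓ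
    · rw [if_pos hp, if_pos (hop.le.trans hp)] at h
      have h1 := (raiseKey_iterate (keyRank_insPerm hg hN π) (Fin.le_def.1 (hop.le.trans hp))).2.2
      have h2 := (raiseKey_iterate (keyRank_insPerm hg hN ρ) (Fin.le_def.1 hp)).2.2
      rw [h, h2] at h1
      exact hop.ne (Fin.ext h1.symm)
    · rw [if_neg hp] at h
      rw [not_le] at hp
      have h3 := isSlot_insWord hg (Fin.le_def.1 hp.le) ρ
      split_ifs at h with ho
      · have h4 := (raiseKey_iterate (keyRank_insPerm hg hN π) (Fin.le_def.1 ho)).1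
        rw [h] at h4
        refine not_isSlot_insWord hg le_rfl hp π ?_
        have h5 := h4.tail p hp
        have h6 := h4.letters
        simp only [permWord_insPerm] at h5 h6
        unfold IsSlot excMark at *
        rwa [← h5, ← h6]
      · refine not_isSlot_insWord hg (Fin.le_def.1 (not_le.1 ho).le) hop π ?_
        rw [← permWord_insPerm, h]
        exact h3
  rintro ⟨π, o⟩ ⟨ρ, p⟩ h
  rcases lt_trichotomy o p with hop | rfl | hop
  · exact absurd h (key π ρ o p hop)
  · simp only at h
    unfold enlarge at h
    split_ifs at h with ho
    · rw [insPerm_injective hg le_rfl (raiseKey_iterate_injective (keyRank_insPerm hg hN π)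
        (keyRank_insPerm hg hN ρ) (Fin.le_def.1 ho) h)]
    · rw [insPerm_injective hg (Fin.le_def.1 (not_le.1 ho).le) h]
  · exact absurd h.symm (key ρ π p o hop)

/-- The increase of the Denert-type statistic under `enlarge`. -/
def enlargeShift (g N L : ℕ) (B : Finset ℕ) (o : ℕ) : ℕ :=
  if o ≤ L then g + B.card + L - o else insShift g N B o

theorem insShift_level {L : ℕ} (hg : 1 ≤ g) (hN : g + L ≤ N) {B : Finset ℕ}
    (hB : ∀ x ∈ B, g + L ≤ x) : insShift g N B L = g + B.card + L := by
  have hv : topLetter g N L = g + L - 1 := by unfold topLetter; omega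
  rw [insShift, hv, if_neg, Finset.filter_true_of_mem]
  · omega
  · intro x hx
    have := hB x hx
    omega
  · rintro (h | h)
    · have := hB _ h
      omega
    · omega

theorem level_le_excLetters {L n : ℕ} {w : Fin n → ℕ} :
    ∀ x ∈ excLetters g (g + L + 1) w, g + L ≤ x := fun x hx => by
  have := le_of_mem_excLetters hx
  omega

theorem permDen_enlarge (hg : 1 ≤ g) (hN : g + ℓ ≤ N) (π : Equiv.Perm (Fin N))
    (o : Fin (N + 1)) : permDen g (g + ℓ + 1) (enlarge g ℓ π o) = permDen g (g + ℓ + 1) π +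
      enlargeShift g N ℓ (excLetters g (g + ℓ + 1) (permWord π)) o := by
  unfold enlarge enlargeShift
  by_cases ho : o ≤ ℓ
  · rw [if_pos ho, if_pos (Fin.le_def.1 ho)]
    have h1 := (raiseKey_iterate (keyRank_insPerm hg hN π) (Fin.le_def.1 ho)).2.1
    rw [permDen_insPerm hg hN le_rfl, insShift_level hg hN level_le_excLetters] at h1
    have := Fin.le_def.1 ho
    omega
  · rw [if_neg ho, if_neg (mt Fin.le_def.2 ho)]
    exact permDen_insPerm hg hN (Fin.le_def.1 (not_le.1 ho).le) π

end option

/-! ### The increases run through all of `{0, …, N}` -/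

section shift

variable {g N L : ℕ} {B : Finset ℕ}

theorem card_filter_lt_of_mem {s t : ℕ} (hs : s ∈ B) (h : s < t) :
    (B.filter (t ≤ ·)).card < (B.filter (s ≤ ·)).card := by
  refine Finset.card_lt_card (Finset.ssubset_iff.2 ⟨s, by simp [h], fun x hx => ?_⟩)
  simp only [Finset.mem_insert, Finset.mem_filter] at hx ⊢
  rcases hx with rfl | hx
  · exact ⟨hs, le_rfl⟩
  · exact ⟨hx.1, by omega⟩

theorem card_filter_le_add {s t : ℕ} :
    (B.filter (s ≤ ·)).card ≤ (B.filter (t ≤ ·)).card + (t - s) := by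
  rw [← Nat.card_Ico s t]
  refine (Finset.card_le_card fun x hx => ?_).trans (Finset.card_union_le _ _)
  simp only [Finset.mem_filter, Finset.mem_union, Finset.mem_Ico] at hx ⊢
  by_cases h : t ≤ x
  · exact Or.inl ⟨hx.1, h⟩
  · exact Or.inr ⟨hx.2, not_le.1 h⟩

theorem card_filter_succ_of_notMem {s : ℕ} (hs : s ∉ B) :
    (B.filter (s ≤ ·)).card = (B.filter (s + 1 ≤ ·)).card := by
  congr 1
  ext x
  simp only [Finset.mem_filter]
  refine and_congr_right fun hx => ?_
  have : x ≠ s := by rintro rfl; exact hs hx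
  omega

/-- The possible values of `insShift`. -/
theorem insShift_cases (hg : 1 ≤ g) (hB : ∀ x ∈ B, g + L ≤ x ∧ x < N) {o : ℕ} (hoL : L < o)
    (hoN : o ≤ N) :
    (N < o + g ∧ insShift g N B o + o = N ∧ insShift g N B o < g) ∨
    (o + g ≤ N ∧ o + g - 1 ∈ B ∧
      insShift g N B o + 1 = g + (B.filter (o + g - 1 ≤ ·)).card ∧
      1 ≤ (B.filter (o + g - 1 ≤ ·)).card ∧ (B.filter (o + g - 1 ≤ ·)).card ≤ B.card) ∨
    (o + g ≤ N ∧ o + g - 1 ∉ B ∧ insShift g N B o = o + g + (B.filter (o + g - 1 ≤ ·)).card ∧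
      g + B.card + L < insShift g N B o ∧ insShift g N B o ≤ N) := by
  by_cases h1 : N < o + g
  · left
    have hv : topLetter g N o = N := by unfold topLetter; omega
    have h2 : (B.filter (N ≤ ·)).card = 0 := by
      rw [Finset.card_eq_zero, Finset.filter_eq_empty_iff]
      exact fun {x} hx => not_le.2 (hB x hx).2
    rw [insShift, hv, if_pos (Or.inr rfl), h2]
    omega
  · have hv : topLetter g N o = o + g - 1 := by unfold topLetter; omega
    right
    by_cases h2 : o + g - 1 ∈ B
    · left
      have h3 := card_filter_lt_of_mem h2 (Nat.lt_succ_self _)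
      have h4 : (B.filter (o + g - 1 ≤ ·)).card ≤ B.card := Finset.card_filter_le _ _
      rw [insShift, hv, if_pos (Or.inl h2)]
      exact ⟨by omega, h2, by omega, by omega, h4⟩
    · right
      have h3 := card_filter_succ_of_notMem h2
      have h4 : (B.filter (g + L ≤ ·)).card = B.card := by
        rw [Finset.filter_true_of_mem fun x hx => (hB x hx).1]
      have h5 := card_filter_le_add (B := B) (s := g + L) (t := o + g - 1)
      have h6 := card_filter_le_add (B := B) (s := o + g - 1 + 1) (t := N)
      have h7 : (B.filter (N ≤ ·)).card = 0 := by
        rw [Finset.card_eq_zero, Finset.filter_eq_empty_iff]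
        exact fun {x} hx => not_le.2 (hB x hx).2
      rw [insShift, hv, if_neg (by rintro (h | h); exacts [h2 h, by omega])]
      refine ⟨by omega, h2, rfl, by omega, by omega⟩

theorem card_add_le (hg : g + L ≤ N) (hB : ∀ x ∈ B, g + L ≤ x ∧ x < N) :
    g + B.card + L ≤ N := by
  have h : B ⊆ Finset.Ico (g + L) N := fun x hx => Finset.mem_Ico.2 (hB x hx)
  have := Finset.card_le_card h
  rw [Nat.card_Ico] at this
  omega

theorem enlargeShift_le (hg : 1 ≤ g) (hN : g + L ≤ N) (hB : ∀ x ∈ B, g + L ≤ x ∧ x < N)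
    {o : ℕ} (hoN : o ≤ N) : enlargeShift g N L B o ≤ N := by
  have h1 := card_add_le hN hB
  unfold enlargeShift
  split_ifs with h
  · omega
  · have := insShift_cases hg hB (not_le.1 h) hoN
    omega

theorem enlargeShift_injOn (hg : 1 ≤ g) (hN : g + L ≤ N) (hB : ∀ x ∈ B, g + L ≤ x ∧ x < N)
    {o p : ℕ} (hoN : o ≤ N) (hpN : p ≤ N) (h : enlargeShift g N L B o = enlargeShift g N L B p) :
    o = p := by
  have h1 := card_add_le hN hB
  -- The three kinds of option have values in disjoint ranges. As the place grows, the values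
  -- strictly decrease for the first two kinds and strictly increase for the third.
  have key : ∀ {o p : ℕ}, o < p → o ≤ N → p ≤ N → L < o → L < p →
      insShift g N B o ≠ insShift g N B p := fun {o p} hop hoN hpN ho hp h => by
    have h2 := insShift_cases hg hB ho hoN
    have h3 := insShift_cases hg hB hp hpN
    have h4 : o + g - 1 ∈ B → (B.filter (p + g - 1 ≤ ·)).card <
        (B.filter (o + g - 1 ≤ ·)).card := fun h => card_filter_lt_of_mem h (by omega)
    have h5 : o + g - 1 ∉ B → (B.filter (o + g - 1 ≤ ·)).card ≤
        (B.filter (p + g - 1 ≤ ·)).card + (p + g - 1 - (o + g - 1 + 1)) := fun h => by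
      rw [card_filter_succ_of_notMem h]
      exact card_filter_le_add
    rcases h2 with h2 | h2 | h2
    · omega
    · have := h4 h2.2.1
      omega
    · have := h5 h2.2.1
      omega
  unfold enlargeShift at h
  split_ifs at h with ho hp hp
  · omega
  · have := insShift_cases hg hB (not_le.1 hp) hpN
    omega
  · have := insShift_cases hg hB (not_le.1 ho) hoN
    omega
  · rcases lt_trichotomy o p with h' | h' | h'
    · exact absurd h (key h' hoN hpN (not_le.1 ho) (not_le.1 hp))
    · exact h'
    · exact absurd h.symm (key h' hpN hoN (not_le.1 hp) (not_le.1 ho))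

end shift

/-! ### The excedance number and the final bijection -/

section main

variable {g N : ℕ} {ℓ : Fin (N + 1)}

theorem excLetters_bounds {g L n : ℕ} {π : Equiv.Perm (Fin n)} :
    ∀ x ∈ excLetters g (g + L + 1) (permWord π), g + L ≤ x ∧ x < n := fun x hx =>
  ⟨level_le_excLetters x hx, lt_of_mem_excLetters x hx⟩

/-- At most `L` excedances lie before place `L`. This keeps the options with `v ∈ B` below the
threshold for `c`. -/
theorem card_excLetters_le_tailExc_add {g L n : ℕ} (hL : L ≤ n) (π : Equiv.Perm (Fin n)) :
    (excLetters g (g + L + 1) (permWord π)).card ≤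
      tailExc g (g + L + 1) L (permWord π) + L := by
  rw [card_excLetters (permWord_injective π), tailExc]
  refine le_of_le_of_eq ?_ (congrArg (_ + ·) (Fin.sum_val_lt hL))
  rw [← Finset.sum_add_distrib]
  refine Finset.sum_le_sum fun i _ => ?_
  by_cases h : excMark g (g + L + 1) (permWord π) i = true
  · simp only [h, true_and, if_true]
    split_ifs <;> omega
  · simp [h]

/-- Of the excedances from `L` on, at most `o - L` lie before `o`; the others have letters at least
`o + g`. This puts the options with `v` outside `B ∪ {N}` above the threshold. -/
theorem tailExc_le_card_filter_add {g L n o : ℕ} (hLo : L ≤ o) (hon : o ≤ n)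
    (π : Equiv.Perm (Fin n)) : tailExc g (g + L + 1) L (permWord π) + L ≤
      ((excLetters g (g + L + 1) (permWord π)).filter (o + g - 1 ≤ ·)).card + o := by
  rw [card_filter_excLetters (permWord_injective π), tailExc]
  refine le_of_eq_of_le (congrArg (_ + ·) (Fin.sum_val_lt (hLo.trans hon)).symm)
    (le_of_le_of_eq ?_ (congrArg (_ + ·) (Fin.sum_val_lt hon)))
  rw [← Finset.sum_add_distrib, ← Finset.sum_add_distrib]
  refine Finset.sum_le_sum fun i _ => ?_
  by_cases h : excMark g (g + L + 1) (permWord π) i = true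
  · have := excMark_iff.1 h
    simp only [h, true_and]
    split_ifs <;> omega
  · simp only [h, false_and, if_false, Bool.false_eq_true]
    split_ifs <;> omega

theorem tailExc_enlarge (hg : 1 ≤ g) (hN : g + ℓ ≤ N) (π : Equiv.Perm (Fin N))
    (o : Fin (N + 1)) : tailExc g (g + ℓ + 1) ℓ (permWord (enlarge g ℓ π o)) =
      if enlargeShift g N ℓ (excLetters g (g + ℓ + 1) (permWord π)) o ≤
        tailExc g (g + ℓ + 1) ℓ (permWord π) + g + (ℓ + 1) - 2
      then tailExc g (g + ℓ + 1) ℓ (permWord π)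
      else tailExc g (g + ℓ + 1) ℓ (permWord π) + 1 := by
  unfold enlarge enlargeShift
  by_cases ho : o ≤ ℓ
  · have ho' := Fin.le_def.1 ho
    rw [if_pos ho, if_pos ho']
    obtain ⟨hs, -, hr⟩ := raiseKey_iterate (keyRank_insPerm hg hN π) ho'
    have h1 := tailExc_add_headExc (g := g) (ℓ := ℓ)
      ((raiseKey (g + ℓ) ℓ)^[o] (insPerm g (g + ℓ + 1) ℓ π))
    have h2 := tailExc_add_headExc (g := g) (ℓ := ℓ) (insPerm g (g + ℓ + 1) ℓ π)
    have hm : excMark g (g + ℓ + 1) (insWord g (g + ℓ + 1) ℓ π) ℓ = true := by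
      rw [excMark_insWord_self hg le_rfl]
      exact fun h => lt_irrefl _ (lt_of_topLetter_mem hg hN le_rfl π h)
    have hcard : (excLetters g (g + ℓ + 1) (insWord g (g + ℓ + 1) ℓ π)).card =
        (excLetters g (g + ℓ + 1) (permWord π)).card + 1 := by
      rw [excLetters_insWord hg le_rfl, if_pos hm,
        Finset.card_insert_of_notMem fun h => lt_irrefl _ (lt_of_mem_excLetters N h)]
    have h3 := tailExc_insWord hg (le_refl (ℓ : ℕ)) π
    -- After `o` exchanges place `ℓ` is an excedance iff `o < headExc`, and `headExc` is `|B| + 1`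
    -- minus the old `tailExc`; this is exactly the threshold for `c`.
    simp only [excMark_iff_keyRank_lt, hr, hs.head, hs.letters] at h1
    rw [permWord_insPerm] at h1 h2
    rw [hm] at h2 h3
    rw [hcard] at h1 h2
    simp only [if_true] at h2 h3
    split_ifs at h1 ⊢ <;> omega
  · have ho' : (ℓ : ℕ) < o := Fin.lt_def.1 (not_le.1 ho)
    have hm := excMark_insWord_self hg ho'.le π
    rw [if_neg ho, if_neg (not_le.2 ho'), permWord_insPerm, tailExc_insWord hg ho'.le]
    have h1 := insShift_cases hg (excLetters_bounds (g := g) (L := ℓ) (π := π)) ho'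
      (Nat.lt_succ_iff.1 o.2)
    have h2 := card_excLetters_le_tailExc_add (g := g) (L := ℓ) (by omega) π
    have h3 := tailExc_le_card_filter_add (g := g) ho'.le (Nat.lt_succ_iff.1 o.2) π
    rcases h1 with h1 | h1 | h1
    · have hv : topLetter g N o = N := by unfold topLetter; omega
      rw [if_neg (fun h => hm.1 h (Or.inr hv)), if_pos (by omega), add_zero]
    · have hv : topLetter g N o = o + g - 1 := by unfold topLetter; omega
      rw [if_neg (fun h => hm.1 h (Or.inl (hv ▸ h1.2.1))), if_pos (by omega), add_zero]
    · have hv : topLetter g N o = o + g - 1 := by unfold topLetter; omega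
      rw [if_pos (hm.2 ?_), if_neg (by omega)]
      rw [hv]
      rintro (h | h)
      · exact h1.2.1 h
      · omega

theorem exists_bijective_level (hg : 1 ≤ g) (hN : g + ℓ ≤ N) :
    ∃ φ : Equiv.Perm (Fin N) × Fin (N + 1) → Equiv.Perm (Fin (N + 1)), Function.Bijective φ ∧
      ∀ π c, gapExc g (ℓ + 1) (φ (π, c)) =
          (if (c : ℕ) ≤ gapExc g (ℓ + 1) π + g + (ℓ + 1) - 2 then gapExc g (ℓ + 1) π
            else gapExc g (ℓ + 1) π + 1) ∧
        permDen g (g + ℓ + 1) (φ (π, c)) = permDen g (g + ℓ + 1) π + c := by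
  let shift (π : Equiv.Perm (Fin N)) (o : Fin (N + 1)) : Fin (N + 1) :=
    ⟨enlargeShift g N ℓ (excLetters g (g + ℓ + 1) (permWord π)) o,
      Nat.lt_succ_iff.2 (enlargeShift_le hg hN excLetters_bounds (Nat.lt_succ_iff.1 o.2))⟩
  have hshift : ∀ π, Function.Bijective (shift π) := fun π =>
    Finite.injective_iff_bijective.1 fun o p h =>
      Fin.ext (enlargeShift_injOn hg hN excLetters_bounds (Nat.lt_succ_iff.1 o.2)
        (Nat.lt_succ_iff.1 p.2) (congrArg Fin.val h))
  let e (π : Equiv.Perm (Fin N)) : Equiv.Perm (Fin (N + 1)) := Equiv.ofBijective _ (hshift π)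
  have he : ∀ π c, enlargeShift g N ℓ (excLetters g (g + ℓ + 1) (permWord π)) ((e π).symm c) =
      (c : ℕ) := fun π c => congrArg Fin.val ((e π).apply_symm_apply c)
  refine ⟨fun x => enlarge g ℓ x.1 ((e x.1).symm x.2), ?_, fun π c => ⟨?_, ?_⟩⟩
  · rw [Fintype.bijective_iff_injective_and_card]
    constructor
    · rintro ⟨π, c⟩ ⟨ρ, d⟩ h
      have h1 := enlarge_injective hg hN (a₁ := (π, (e π).symm c)) (a₂ := (ρ, (e ρ).symm d)) h
      obtain ⟨rfl, h2⟩ := Prod.mk.inj h1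
      rw [(e π).symm.injective h2]
    · rw [Fintype.card_prod, Fintype.card_perm, Fintype.card_perm, Fintype.card_fin,
        Fintype.card_fin, Nat.factorial_succ, mul_comm]
  · rw [gapExc_eq_tailExc, gapExc_eq_tailExc, tailExc_enlarge hg hN, he]
  · rw [permDen_enlarge hg hN, he]

end main

/-- The bijection at level `g + ℓ` is composed with the level change in size `n - 1` and the inverse
level change in size `n`. -/
theorem mainTheorem3 (n g ℓ : ℕ) (hg : 1 ≤ g) (hℓ : 1 ≤ ℓ) (hn : g + ℓ ≤ n) :
    ∃ φ : Equiv.Perm (Fin (n - 1)) × Fin n → Equiv.Perm (Fin n),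
      Function.Bijective φ ∧
      ∀ (π : Equiv.Perm (Fin (n - 1))) (c : Fin n),
        gapExc g ℓ (φ (π, c)) =
            (if (c : ℕ) ≤ gapExc g ℓ π + g + ℓ - 2 then gapExc g ℓ π else gapExc g ℓ π + 1) ∧
        gapDen g ℓ (φ (π, c)) = gapDen g ℓ π + (c : ℕ) := by
  obtain ⟨m, rfl⟩ : ∃ m, n = m + 2 := ⟨n - 2, by omega⟩
  obtain ⟨L, rfl⟩ : ∃ L, ℓ = L + 1 := ⟨ℓ - 1, by omega⟩
  change ∃ φ : Equiv.Perm (Fin (m + 1)) × Fin (m + 1 + 1) → Equiv.Perm (Fin (m + 1 + 1)), _ ∧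
    ∀ (π : Equiv.Perm (Fin (m + 1))) (c : Fin (m + 1 + 1)), _
  obtain ⟨Λ, hΛ, hΛs⟩ := exists_bijective_permDen_level (m := m) hg hℓ (by omega) g le_rfl
  obtain ⟨Λ', hΛ', hΛs'⟩ := exists_bijective_permDen_level (m := m + 1) hg hℓ (by omega) g le_rfl
  obtain ⟨φ, hφ, hφs⟩ := exists_bijective_level (N := m + 1) (ℓ := ⟨L, by omega⟩) hg
    (by simp only; omega)
  simp only at hφs
  have hlev : L + 1 + g = g + L + 1 := by omega
  rw [hlev] at hΛs hΛs'
  let e := Equiv.ofBijective Λ' hΛ'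
  have he : ∀ σ, Λ' (e.symm σ) = σ := fun σ => e.apply_symm_apply σ
  refine ⟨fun x => e.symm (φ (Λ x.1, x.2)), ?_, fun π c => ⟨?_, ?_⟩⟩
  · exact e.symm.bijective.comp (hφ.comp (hΛ.prodMap Function.bijective_id))
  · have h1 := (hΛs' (e.symm (φ (Λ π, c)))).1
    rw [he] at h1
    rw [← h1, (hφs (Λ π) c).1, (hΛs π).1]
  · have h1 := (hΛs' (e.symm (φ (Λ π, c)))).2
    rw [he] at h1
    rw [gapDen_eq_permDen, gapDen_eq_permDen, ← h1, (hφs (Λ π) c).2, (hΛs π).2]
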